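/- Let $X$ be a complex Banach space and let $A$ be a sectorial operator on $X$, not necessarily injective: $A$ is a densely defined linear operator, $\sigma(A)\subset\mathbb C\setminus(-\infty,0)$ and $\sup_{s>0}\|(1+sA)^{-1}\|<\infty$. In all integrals over $[0,\infty)$ below, $(1+sA)^{-1}$ is read as the identity operator for $s=0$. **Stieltjes calculus.** Let $\tilde{\mathcal S}_b$ be the algebra of all functions on $\mathbb C\setminus(-\infty,0]$ of the form $$g(z)=\int_{[0,\infty)}\frac{\nu(ds)}{(1+zs)^m},$$ where $m\ge 1$ is an integer and $\nu$ is a complex Radon measure of finite total variation on $[0,\infty)$. For such $g$ let $$\Phi(g)=\int_{[0,\infty)}(1+sA)^{-m}\,\nu(ds),$$ a bounded operator on $X$. A regulariser of a holomorphic function $f$ on $\mathbb C\setminus(-\infty,0]$ is a function $e\in\tilde{\mathcal S}_b$ such that $ef\in\tilde{\mathcal S}_b$ and $\Phi(e)$ is injective. If $f$ has a regulariser $e$, then $$f_S(A):=\Phi(e)^{-1}\Phi(ef),\qquad \operatorname{dom}(f_S(A))=\{x\in X:\Phi(ef)x\in\operatorname{ran}\Phi(e)\}.$$ **Hirsch-type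 operator.** Let $n\ge1$ be an integer, $a\in\mathbb C$, and let $\mu$ be a complex Radon measure on $[0,\infty)$ with $\int_{[0,\infty)}(1+s)^{-n}\,|\mu|(ds)<\infty$. Let $$f(z)=a+\int_{[0,\infty)}\frac{z^n}{(1+zs)^n}\,\mu(ds),\qquad z\in\mathbb C\setminus(-\infty,0],$$ and define $$\hat f(A)x=ax+\int_{[0,\infty)}A^n(1+sA)^{-n}x\,\mu(ds),\qquad x\in\operatorname{dom}(\hat f(A))=\operatorname{dom}(A^n),$$ where the integral converges absolutely. **Claim.** The function $z\mapsto(1+z)^{-n}$ is a regulariser of $f$, the operator $f_S(A)$ does not depend on the choice of the regulariser, the operator $\hat f(A)$ is closable, and, with $f_H(A):=\overline{\hat f(A)}$, $$f_S(A)=f_H(A),$$ including equality of the domains. -/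

import Mathlib

open MeasureTheory
open scoped NNReal

noncomputable section

namespace SectorialCalculus

/-! ### Complex Radon measures on `[0, ∞)` -/

/-- A complex Radon measure on `[0, ∞)`, given by its polar decomposition `dμ = h d|μ|`: the total
variation `|μ|` is a positive Radon measure (a locally finite Borel measure on the half-line), not
necessarily finite, and the phase `h` is a measurable function of modulus one. -/
structure ComplexRadonMeasure where
  variation : Measure ℝ≥0
  locallyFinite : IsLocallyFiniteMeasure variation
  phase : ℝ≥0 → ℂ
  measurable_phase : Measurable phase
  norm_phase : ∀ s, ‖phase s‖ = 1

/-- The integral `∫_{[0, ∞)} g(s) μ(ds)` of a vector-valued function. -/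
def ComplexRadonMeasure.integral {E : Type*} [NormedAddCommGroup E] [NormedSpace ℂ E]
    (μ : ComplexRadonMeasure) (g : ℝ≥0 → E) : E :=
  ∫ s, μ.phase s • g s ∂μ.variation

section Operators

variable {X : Type*} [NormedAddCommGroup X] [NormedSpace ℂ X]

/-! ### Unbounded operators -/

/-- The product `B A` with domain `{x ∈ dom A : A x ∈ dom B}`. -/
def opComp (B A : X →ₗ.[ℂ] X) : X →ₗ.[ℂ] X where
  domain := (B.domain.comap A.toFun).map A.domain.subtype
  toFun :=
    { toFun := fun x => B ⟨A ⟨x.1, by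
          obtain ⟨y, _, hy⟩ := x.2
          exact hy ▸ y.2⟩, by
          obtain ⟨_, y, hy, rfl⟩ := x
          exact hy⟩
      map_add' := by
        rintro ⟨_, y, hy, rfl⟩ ⟨_, z, hz, rfl⟩
        rw [← LinearPMap.map_add]
        congr 1
        apply Subtype.ext
        exact LinearPMap.map_add A y z
      map_smul' := by
        rintro c ⟨_, y, hy, rfl⟩
        rw [RingHom.id_apply, ← LinearPMap.map_smul]
        congr 1
        apply Subtype.ext
        exact LinearPMap.map_smul A c y }

theorem mem_opComp_domain {B A : X →ₗ.[ℂ] X} {x : X} :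
    x ∈ (opComp B A).domain ↔ ∃ h : x ∈ A.domain, A ⟨x, h⟩ ∈ B.domain := by
  constructor
  · rintro ⟨y, hy, rfl⟩
    exact ⟨y.2, hy⟩
  · rintro ⟨h, hx⟩
    exact ⟨⟨x, h⟩, hx, rfl⟩

/-- The power `A ^ n` of an unbounded operator with its natural domain; `A ^ 0` is the identity. -/
def opPow (A : X →ₗ.[ℂ] X) : ℕ → (X →ₗ.[ℂ] X)
  | 0 => (LinearMap.id : X →ₗ[ℂ] X).toPMap ⊤
  | n + 1 => opComp A (opPow A n)

/-- The operator `c + d A` with domain `dom A`. -/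
def affineOp (c d : ℂ) (A : X →ₗ.[ℂ] X) : X →ₗ.[ℂ] X :=
  (c • (LinearMap.id : X →ₗ[ℂ] X)) +ᵥ (d • A)

/-- `T` is a bijection of `dom T` onto `X` and the bounded operator `R` is its inverse. -/
def IsBoundedInverse (T : X →ₗ.[ℂ] X) (R : X →L[ℂ] X) : Prop :=
  (∀ x, ∃ h : R x ∈ T.domain, T ⟨R x, h⟩ = x) ∧ ∀ x : T.domain, R (T x) = x

open Classical in
/-- The bounded inverse `T⁻¹` (zero if there is none). -/
def boundedInverse (T : X →ₗ.[ℂ] X) : X →L[ℂ] X :=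
  if h : ∃ R, IsBoundedInverse T R then h.choose else 0

/-- The spectrum `σ(A)`. -/
def opSpectrum (A : X →ₗ.[ℂ] X) : Set ℂ :=
  {z | ¬ ∃ R, IsBoundedInverse (affineOp z (-1) A) R}

open Classical in
/-- The operator `(1 + s A)⁻¹`, read as the identity operator for `s = 0`. -/
def resolventOp (A : X →ₗ.[ℂ] X) (s : ℝ≥0) : X →L[ℂ] X :=
  if s = 0 then 1 else boundedInverse (affineOp 1 ((s : ℝ) : ℂ) A)

/-- Sectorial (non-negative) operators: densely defined, `σ(A) ⊆ ℂ \ (-∞, 0)`, and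
`sup_{s > 0} ‖(1 + s A)⁻¹‖ < ∞`. -/
structure IsSectorial (A : X →ₗ.[ℂ] X) : Prop where
  dense_domain : Dense (A.domain : Set X)
  spectrum_subset : ∀ r : ℝ, r < 0 → (r : ℂ) ∉ opSpectrum A
  bounded_resolvent : ∃ M : ℝ, ∀ s : ℝ≥0, 0 < s → ‖resolventOp A s‖ ≤ M

/-! ### The Stieltjes calculus -/

/-- `ν` is a complex Radon measure of finite total variation that represents the function `f` on
the cut plane as `f(z) = ∫ (1 + z s)⁻ⁿ ν(ds)`. -/
def IsStieltjesRep (n : ℕ) (ν : ComplexRadonMeasure) (f : ℂ → ℂ) : Prop :=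
  IsFiniteMeasure ν.variation ∧
    ∀ z ∈ Complex.slitPlane, f z = ν.integral fun s => 1 / (1 + z * ((s : ℝ) : ℂ)) ^ n

/-- The bounded Stieltjes algebra: the union over `n ≥ 1` of the classes of functions with a
representation `f(z) = ∫ (1 + z s)⁻ⁿ ν(ds)`. Only the values on the cut plane matter. -/
def boundedStieltjes : Set (ℂ → ℂ) :=
  {f | ∃ n : ℕ, 1 ≤ n ∧ ∃ ν, IsStieltjesRep n ν f}

open Classical in
/-- The Stieltjes calculus on the bounded Stieltjes algebra: `Φ(f) = ∫ (1 + s A)⁻ⁿ ν(ds)` if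
`f(z) = ∫ (1 + z s)⁻ⁿ ν(ds)`. -/
def stieltjesMap (A : X →ₗ.[ℂ] X) (f : ℂ → ℂ) : X →L[ℂ] X :=
  if h : ∃ p : ℕ × ComplexRadonMeasure, 1 ≤ p.1 ∧ IsStieltjesRep p.1 p.2 f then
    h.choose.2.integral fun s => resolventOp A s ^ h.choose.1
  else 0

/-- The regularisers of `f` in the Stieltjes calculus for `A`, where `f` has to be holomorphic in
the cut plane: those `e` in the bounded Stieltjes algebra such that `e f` also belongs to it and
`Φ(e)` is injective. -/
def regularisers (A : X →ₗ.[ℂ] X) (f : ℂ → ℂ) : Set (ℂ → ℂ) :=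
  {e | DifferentiableOn ℂ f Complex.slitPlane ∧ e ∈ boundedStieltjes ∧
    (fun z => e z * f z) ∈ boundedStieltjes ∧ Function.Injective (stieltjesMap A e)}

/-- The operator `Φ(e)⁻¹ Φ(e f)` with its natural domain `{x : Φ(e f) x ∈ ran Φ(e)}`. -/
def regularisedOp (A : X →ₗ.[ℂ] X) (e f : ℂ → ℂ) : X →ₗ.[ℂ] X :=
  opComp ((stieltjesMap A e).toLinearMap.toPMap ⊤).inverse
    ((stieltjesMap A fun z => e z * f z).toLinearMap.toPMap ⊤)

open Classical in
/-- The operator `f_S(A) = Φ(e)⁻¹ Φ(e f)` of the extended Stieltjes calculus, for a regulariser `e`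
of `f` (zero on the domain `{0}` if `f` is not regularisable). -/
def extendedStieltjes (A : X →ₗ.[ℂ] X) (f : ℂ → ℂ) : X →ₗ.[ℂ] X :=
  if h : (regularisers A f).Nonempty then regularisedOp A h.some f else ⊥

/-! ### The Hirsch-type operator -/

/-- The integrability condition `∫ (1 + s)⁻ⁿ |μ|(ds) < ∞`. -/
def IsAdmissible (n : ℕ) (μ : ComplexRadonMeasure) : Prop :=
  Integrable (fun s : ℝ≥0 => 1 / (1 + (s : ℝ)) ^ n) μ.variation

/-- On the cut plane, `f` is represented as `f(z) = a + ∫ zⁿ (1 + z s)⁻ⁿ μ(ds)`, where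
`∫ (1 + s)⁻ⁿ |μ|(ds) < ∞`. -/
def IsBernsteinRep (n : ℕ) (a : ℂ) (μ : ComplexRadonMeasure) (f : ℂ → ℂ) : Prop :=
  IsAdmissible n μ ∧
    ∀ z ∈ Complex.slitPlane, f z = a + μ.integral fun s => z ^ n / (1 + z * ((s : ℝ) : ℂ)) ^ n

/-- The bounded operator `A (1 + s A)⁻¹ = s⁻¹ (1 - (1 + s A)⁻¹)`, for `s > 0`. -/
def yosidaOp (A : X →ₗ.[ℂ] X) (s : ℝ≥0) : X →L[ℂ] X :=
  ((s : ℝ) : ℂ)⁻¹ • (1 - resolventOp A s)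

variable {A : X →ₗ.[ℂ] X}

theorem resolventOp_zero : resolventOp A 0 = 1 := by
  simp [resolventOp]

theorem IsSectorial.isBoundedInverse (hA : IsSectorial A) {s : ℝ≥0} (hs : 0 < s) :
    IsBoundedInverse (affineOp 1 ((s : ℝ) : ℂ) A) (resolventOp A s) := by
  have hs0 : ((s : ℝ) : ℂ) ≠ 0 := by exact_mod_cast hs.ne'
  have hex : ∃ R, IsBoundedInverse (affineOp 1 ((s : ℝ) : ℂ) A) R := by
    have hneg : (-(s : ℝ)⁻¹) < 0 := by
      have : (0 : ℝ) < s := by exact_mod_cast hs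
      simpa using this
    have hr := hA.spectrum_subset _ hneg
    simp only [opSpectrum, Set.mem_ofPred_eq, not_not] at hr
    obtain ⟨R, h1, h2⟩ := hr
    refine ⟨(-((s : ℝ) : ℂ)⁻¹) • R, fun x => ?_, fun x => ?_⟩
    · obtain ⟨h, hx⟩ := h1 x
      have hm : R x ∈ A.domain := h
      refine ⟨A.domain.smul_mem _ hm, ?_⟩
      have e1 : affineOp ((-(s : ℝ)⁻¹ : ℝ) : ℂ) (-1) A ⟨R x, h⟩
          = ((-(s : ℝ)⁻¹ : ℝ) : ℂ) • R x + (-1 : ℂ) • A ⟨R x, hm⟩ := rfl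
      have e2 : ∀ h', affineOp 1 ((s : ℝ) : ℂ) A ⟨((-((s : ℝ) : ℂ)⁻¹) • R) x, h'⟩
          = (1 : ℂ) • ((-((s : ℝ) : ℂ)⁻¹) • R x)
            + ((s : ℝ) : ℂ) • A ((-((s : ℝ) : ℂ)⁻¹) • ⟨R x, hm⟩) := fun _ => rfl
      refine (e2 _).trans ?_
      have e3 : ((s : ℝ) : ℂ) * (-((s : ℝ) : ℂ)⁻¹) = -1 := by
        rw [mul_neg, mul_inv_cancel₀ hs0]
      rw [LinearPMap.map_smul, smul_smul ((s : ℝ) : ℂ), e3, one_smul]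
      rw [e1] at hx
      push_cast at hx
      exact hx
    · have hx := h2 x
      have e1 : affineOp ((-(s : ℝ)⁻¹ : ℝ) : ℂ) (-1) A x
          = ((-(s : ℝ)⁻¹ : ℝ) : ℂ) • (x : X) + (-1 : ℂ) • A x := rfl
      have e2 : affineOp 1 ((s : ℝ) : ℂ) A x
          = (1 : ℂ) • (x : X) + ((s : ℝ) : ℂ) • A x := rfl
      rw [e1] at hx
      have e3 : (-((s : ℝ) : ℂ)⁻¹) * ((s : ℝ) : ℂ) = -1 := by
        rw [neg_mul, inv_mul_cancel₀ hs0]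
      rw [e2, smul_apply, ← map_smul, smul_add, smul_smul, smul_smul, e3, mul_one]
      push_cast at hx
      exact hx
  have hne : s ≠ 0 := hs.ne'
  rw [resolventOp, if_neg hne, boundedInverse, dif_pos hex]
  exact hex.choose_spec

theorem IsSectorial.resolventOp_mem (hA : IsSectorial A) {s : ℝ≥0} (hs : 0 < s) (x : X) :
    ∃ h : resolventOp A s x ∈ A.domain, A ⟨resolventOp A s x, h⟩ = yosidaOp A s x := by
  have hs0 : ((s : ℝ) : ℂ) ≠ 0 := by exact_mod_cast hs.ne'
  obtain ⟨h, hx⟩ := (hA.isBoundedInverse hs).1 x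
  have hm : resolventOp A s x ∈ A.domain := h
  have e : affineOp 1 ((s : ℝ) : ℂ) A ⟨resolventOp A s x, h⟩
    = (1 : ℂ) • resolventOp A s x + ((s : ℝ) : ℂ) • A ⟨resolventOp A s x, hm⟩ := rfl
  refine ⟨hm, ?_⟩
  rw [e, one_smul] at hx
  rw [yosidaOp, smul_apply, sub_apply,
    one_apply_eq_self]
  rw [eq_inv_smul_iff₀ hs0]
  exact eq_sub_of_add_eq' hx

theorem IsSectorial.yosidaOp_apply_of_mem (hA : IsSectorial A) {s : ℝ≥0} (hs : 0 < s)
    (x : A.domain) : yosidaOp A s x = resolventOp A s (A x) := by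
  have hs0 : ((s : ℝ) : ℂ) ≠ 0 := by exact_mod_cast hs.ne'
  have hx := (hA.isBoundedInverse hs).2 x
  have e : affineOp 1 ((s : ℝ) : ℂ) A x
    = (1 : ℂ) • (x : X) + ((s : ℝ) : ℂ) • A x := rfl
  rw [e, one_smul, map_add, map_smul] at hx
  rw [yosidaOp, smul_apply, sub_apply,
    one_apply_eq_self, inv_smul_eq_iff₀ hs0]
  exact sub_eq_of_eq_add' hx.symm

theorem commute_resolventOp_yosidaOp (s : ℝ≥0) : Commute (resolventOp A s) (yosidaOp A s) :=
  ((Commute.one_right _).sub_right (Commute.refl _)).smul_right _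

/-- For `s > 0`, the operator `A ^ n (1 + s A)⁻ⁿ` is everywhere defined and bounded. -/
theorem IsSectorial.opPow_resolventOp (hA : IsSectorial A) {s : ℝ≥0} (hs : 0 < s) (n : ℕ) (x : X) :
    ∃ h : (resolventOp A s ^ n) x ∈ (opPow A n).domain,
      opPow A n ⟨(resolventOp A s ^ n) x, h⟩ = (yosidaOp A s ^ n) x := by
  induction n generalizing x with
  | zero => exact ⟨trivial, rfl⟩
  | succ n ih =>
    obtain ⟨h, hx⟩ := ih (resolventOp A s x)
    have e : (resolventOp A s ^ (n + 1)) x = (resolventOp A s ^ n) (resolventOp A s x) := by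
      rw [pow_succ, mul_apply_eq_comp]
    have hc : (yosidaOp A s ^ n) (resolventOp A s x)
        = resolventOp A s ((yosidaOp A s ^ n) x) := by
      have := ((commute_resolventOp_yosidaOp (A := A) s).pow_right n).eq
      simpa using (congrArg (fun T : X →L[ℂ] X => T x) this).symm
    obtain ⟨h', hx'⟩ := hA.resolventOp_mem hs ((yosidaOp A s ^ n) x)
    rw [e]
    have key : opPow A n ⟨(resolventOp A s ^ n) (resolventOp A s x), h⟩
        = resolventOp A s ((yosidaOp A s ^ n) x) := hx.trans hc
    refine ⟨mem_opComp_domain.2 ⟨h, key ▸ h'⟩, ?_⟩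
    have : opPow A (n + 1) ⟨(resolventOp A s ^ n) (resolventOp A s x),
        mem_opComp_domain.2 ⟨h, key ▸ h'⟩⟩
        = A ⟨opPow A n ⟨(resolventOp A s ^ n) (resolventOp A s x), h⟩, key ▸ h'⟩ := rfl
    rw [this, pow_succ', mul_apply_eq_comp, ← hx']
    congr 1
    exact Subtype.ext key

theorem IsSectorial.yosidaOp_pow_apply (hA : IsSectorial A) {s : ℝ≥0} (hs : 0 < s) (n : ℕ)
    (x : (opPow A n).domain) :
    (yosidaOp A s ^ n) x = (resolventOp A s ^ n) (opPow A n x) := by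
  induction n with
  | zero => rfl
  | succ n ih =>
    obtain ⟨x, hx⟩ := x
    obtain ⟨h, hx'⟩ := mem_opComp_domain.1 hx
    have hc : yosidaOp A s ((resolventOp A s ^ n) (opPow A n ⟨x, h⟩))
        = (resolventOp A s ^ n) (yosidaOp A s (opPow A n ⟨x, h⟩)) := by
      have := ((commute_resolventOp_yosidaOp (A := A) s).pow_left n).eq
      simpa using (congrArg (fun T : X →L[ℂ] X => T (opPow A n ⟨x, h⟩)) this).symm
    have e := hA.yosidaOp_apply_of_mem hs ⟨opPow A n ⟨x, h⟩, hx'⟩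
    have e' : opPow A (n + 1) ⟨x, hx⟩ = A ⟨opPow A n ⟨x, h⟩, hx'⟩ := rfl
    have ih' := ih ⟨x, h⟩
    simp only at ih' e ⊢
    rw [pow_succ', mul_apply_eq_comp, ih', hc, e, e', pow_succ,
      mul_apply_eq_comp]

theorem IsSectorial.resolventOp_pow_mem (hA : IsSectorial A) (n : ℕ) (s : ℝ≥0)
    (x : (opPow A n).domain) : (resolventOp A s ^ n) x ∈ (opPow A n).domain := by
  rcases eq_or_lt_of_le (zero_le (a := s)) with rfl | hs
  · rw [resolventOp_zero, one_pow]
    exact x.2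
  · exact (hA.opPow_resolventOp hs n x).1

/-- The vector `A ^ n (1 + s A)⁻ⁿ x`, for `x ∈ dom(A ^ n)` and `s ≥ 0`. -/
def hirschIntegrand (hA : IsSectorial A) (n : ℕ) (x : (opPow A n).domain) (s : ℝ≥0) : X :=
  opPow A n ⟨(resolventOp A s ^ n) x, hA.resolventOp_pow_mem n s x⟩

theorem hirschIntegrand_of_pos (hA : IsSectorial A) (n : ℕ) (x : (opPow A n).domain) {s : ℝ≥0}
    (hs : 0 < s) : hirschIntegrand hA n x s = (yosidaOp A s ^ n) x :=
  (hA.opPow_resolventOp hs n x).2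

theorem hirschIntegrand_zero (hA : IsSectorial A) (n : ℕ) (x : (opPow A n).domain) :
    hirschIntegrand hA n x 0 = opPow A n x := by
  unfold hirschIntegrand
  congr 1
  apply Subtype.ext
  simp [resolventOp_zero]

theorem IsSectorial.norm_yosidaOp_le {M : ℝ}
    (hM : ∀ s : ℝ≥0, 0 < s → ‖resolventOp A s‖ ≤ M) {s : ℝ≥0} (hs : 0 < s) :
    ‖yosidaOp A s‖ ≤ (s : ℝ)⁻¹ * (1 + M) := by
  rw [yosidaOp, norm_smul]
  have h1 : ‖(((s : ℝ) : ℂ)⁻¹)‖ = (s : ℝ)⁻¹ := by simp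
  rw [h1]
  gcongr
  calc ‖1 - resolventOp A s‖ ≤ ‖(1 : X →L[ℂ] X)‖ + ‖resolventOp A s‖ := norm_sub_le _ _
    _ ≤ 1 + M := add_le_add ContinuousLinearMap.norm_id_le (hM s hs)

/-- The map `s ↦ (1 + s A)⁻¹` is norm continuous on `(0, ∞)`. -/
theorem IsSectorial.continuousOn_resolventOp (hA : IsSectorial A) :
    ContinuousOn (resolventOp A) (Set.Ioi 0) := by
  obtain ⟨M, hM⟩ := hA.bounded_resolvent
  have key : ∀ s t : ℝ≥0, 0 < s → 0 < t → resolventOp A s - resolventOp A t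
      = (((t : ℝ) : ℂ) - ((s : ℝ) : ℂ)) • (resolventOp A s * yosidaOp A t) := by
    intro s t hs ht
    ext x
    obtain ⟨h, hx⟩ := hA.resolventOp_mem ht x
    have h1 := (hA.isBoundedInverse hs).2 ⟨resolventOp A t x, h⟩
    have e1 : affineOp 1 ((s : ℝ) : ℂ) A ⟨resolventOp A t x, h⟩
      = (1 : ℂ) • resolventOp A t x + ((s : ℝ) : ℂ) • A ⟨resolventOp A t x, h⟩ := rfl
    have ht0 : ((t : ℝ) : ℂ) ≠ 0 := by exact_mod_cast ht.ne'
    have e2 : x = resolventOp A t x + ((t : ℝ) : ℂ) • yosidaOp A t x := by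
      rw [yosidaOp, smul_apply, smul_inv_smul₀ ht0,
        sub_apply, one_apply_eq_self, add_sub_cancel]
    rw [e1, hx, one_smul, map_add, map_smul] at h1
    simp only at h1
    rw [sub_apply, smul_apply,
      mul_apply_eq_comp, sub_smul]
    nth_rewrite 1 [e2]
    nth_rewrite 2 [← h1]
    rw [map_add, map_smul]
    abel
  intro t ht
  have ht' : 0 < t := ht
  rw [ContinuousWithinAt, tendsto_iff_norm_sub_tendsto_zero]
  have hb : Filter.Tendsto (fun s : ℝ≥0 => |(t : ℝ) - s| * (M * ‖yosidaOp A t‖))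
      (nhdsWithin t (Set.Ioi 0)) (nhds 0) := by
    have : Continuous fun s : ℝ≥0 => |(t : ℝ) - s| * (M * ‖yosidaOp A t‖) := by fun_prop
    have h2 := (this.tendsto t).mono_left (nhdsWithin_le_nhds (s := Set.Ioi (0 : ℝ≥0)))
    simpa using h2
  refine squeeze_zero' (Filter.Eventually.of_forall fun _ => norm_nonneg _) ?_ hb
  filter_upwards [self_mem_nhdsWithin] with s hs
  rw [key s t hs ht', norm_smul]
  have e : ‖((t : ℝ) : ℂ) - ((s : ℝ) : ℂ)‖ = |(t : ℝ) - s| := by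
    rw [← Complex.ofReal_sub, Complex.norm_real, Real.norm_eq_abs]
  rw [e]
  gcongr
  exact (norm_mul_le _ _).trans (by gcongr; exact hM s hs)

theorem IsSectorial.continuousOn_hirschIntegrand (hA : IsSectorial A) (n : ℕ)
    (x : (opPow A n).domain) : ContinuousOn (hirschIntegrand hA n x) (Set.Ioi 0) := by
  have hy : ContinuousOn (yosidaOp A) (Set.Ioi 0) := by
    unfold yosidaOp
    have hc : ContinuousOn (fun s : ℝ≥0 => ((s : ℝ) : ℂ)) (Set.Ioi 0) := by fun_prop
    refine ContinuousOn.smul (hc.inv₀ ?_)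
      (continuousOn_const.sub hA.continuousOn_resolventOp)
    intro s hs
    have : (0 : ℝ≥0) < s := hs
    exact_mod_cast this.ne'
  have := (hy.pow n).clm_apply (continuousOn_const (c := (x : X)))
  exact this.congr fun s hs => hirschIntegrand_of_pos hA n x hs

theorem IsSectorial.exists_norm_hirschIntegrand_le (hA : IsSectorial A) (n : ℕ)
    (x : (opPow A n).domain) :
    ∃ C : ℝ, ∀ s, ‖hirschIntegrand hA n x s‖ ≤ C * (1 / (1 + (s : ℝ)) ^ n) := by
  obtain ⟨M₀, hM₀⟩ := hA.bounded_resolvent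
  set M := max M₀ 1 with hMdef
  have hM1 : 1 ≤ M := le_max_right _ _
  have hM : ∀ s : ℝ≥0, 0 < s → ‖resolventOp A s‖ ≤ M := fun s hs =>
    (hM₀ s hs).trans (le_max_left _ _)
  have hM0 : 0 ≤ M := zero_le_one.trans hM1
  refine ⟨max (M ^ n * ‖opPow A n x‖ * 2 ^ n) ((1 + M) ^ n * ‖(x : X)‖ * 2 ^ n), fun s => ?_⟩
  have hpos : (0 : ℝ) < 1 + s := by positivity
  rw [mul_one_div, le_div_iff₀ (by positivity)]
  rcases le_total (s : ℝ) 1 with h1 | h1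
  · refine le_trans ?_ (le_max_left _ _)
    have hb : ‖hirschIntegrand hA n x s‖ ≤ M ^ n * ‖opPow A n x‖ := by
      rcases eq_or_lt_of_le (zero_le (a := s)) with rfl | hs
      · rw [hirschIntegrand_zero]
        exact le_mul_of_one_le_left (norm_nonneg _) (one_le_pow₀ hM1)
      · rw [hirschIntegrand_of_pos hA n x hs, hA.yosidaOp_pow_apply hs]
        refine (ContinuousLinearMap.le_opNorm _ _).trans ?_
        gcongr
        rcases n.eq_zero_or_pos with rfl | hn
        · exact (ContinuousLinearMap.norm_id_le : ‖ContinuousLinearMap.id ℂ X‖ ≤ 1)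
        · exact (norm_pow_le' _ hn).trans (pow_le_pow_left₀ (norm_nonneg _) (hM s hs) n)
    gcongr
    linarith
  · refine le_trans ?_ (le_max_right _ _)
    have hs : 0 < s := by
      have : (0 : ℝ) < s := by linarith
      exact_mod_cast this
    have hs' : (0 : ℝ) < s := by exact_mod_cast hs
    have hb : ‖hirschIntegrand hA n x s‖ ≤ ((s : ℝ)⁻¹ * (1 + M)) ^ n * ‖(x : X)‖ := by
      rw [hirschIntegrand_of_pos hA n x hs]
      refine (ContinuousLinearMap.le_opNorm _ _).trans ?_
      gcongr
      rcases n.eq_zero_or_pos with rfl | hn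
      · exact (ContinuousLinearMap.norm_id_le : ‖ContinuousLinearMap.id ℂ X‖ ≤ 1)
      · exact (norm_pow_le' _ hn).trans
          (pow_le_pow_left₀ (norm_nonneg _) (IsSectorial.norm_yosidaOp_le hM hs) n)
    calc ‖hirschIntegrand hA n x s‖ * (1 + (s : ℝ)) ^ n
        ≤ (((s : ℝ)⁻¹ * (1 + M)) ^ n * ‖(x : X)‖) * (2 * s) ^ n := by
          gcongr
          linarith
      _ = (1 + M) ^ n * ‖(x : X)‖ * 2 ^ n := by
          rw [mul_pow, mul_pow, inv_pow]
          field_simp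

/-- The integral that defines the Hirsch-type operator converges absolutely on `dom(A ^ n)`. -/
theorem IsSectorial.integrable_hirschIntegrand (hA : IsSectorial A) {n : ℕ}
    {μ : ComplexRadonMeasure} (hμ : IsAdmissible n μ) (x : (opPow A n).domain) :
    Integrable (fun s => μ.phase s • hirschIntegrand hA n x s) μ.variation := by
  obtain ⟨C, hC⟩ := hA.exists_norm_hirschIntegrand_le n x
  refine (Integrable.const_mul hμ C).mono' ?_ (Filter.Eventually.of_forall fun s => ?_)
  · refine μ.measurable_phase.aestronglyMeasurable.smul ?_
    have hu : (Set.Ioi (0 : ℝ≥0)) ∪ {0} = Set.univ := by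
      ext s
      simp
    rw [← Measure.restrict_univ (μ := μ.variation), ← hu, aestronglyMeasurable_union_iff]
    refine ⟨(hA.continuousOn_hirschIntegrand n x).aestronglyMeasurable measurableSet_Ioi, ?_⟩
    exact (continuousOn_singleton _ _).aestronglyMeasurable (measurableSet_singleton _)
  · rw [norm_smul, μ.norm_phase, one_mul]
    exact hC s

/-- The Hirsch-type operator `f̂(A) x = a x + ∫ A ^ n (1 + s A)⁻ⁿ x μ(ds)` with domain
`dom(A ^ n)`. -/
def hirschOp (hA : IsSectorial A) {n : ℕ} (a : ℂ) {μ : ComplexRadonMeasure}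
    (hμ : IsAdmissible n μ) : X →ₗ.[ℂ] X where
  domain := (opPow A n).domain
  toFun :=
    { toFun := fun x => a • (x : X) + μ.integral (hirschIntegrand hA n x)
      map_add' := fun x y => by
        have e : ∀ s, hirschIntegrand hA n (x + y) s
            = hirschIntegrand hA n x s + hirschIntegrand hA n y s := fun s => by
          unfold hirschIntegrand
          rw [← LinearPMap.map_add]
          congr 1
          apply Subtype.ext
          simp
        simp only [ComplexRadonMeasure.integral, e, smul_add, Submodule.coe_add]
        rw [integral_add (hA.integrable_hirschIntegrand hμ x) (hA.integrable_hirschIntegrand hμ y)]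
        abel
      map_smul' := fun c x => by
        have e : ∀ s, hirschIntegrand hA n (c • x) s = c • hirschIntegrand hA n x s := fun s => by
          unfold hirschIntegrand
          rw [← LinearPMap.map_smul]
          congr 1
          apply Subtype.ext
          simp
        simp only [ComplexRadonMeasure.integral, e, RingHom.id_apply, Submodule.coe_smul,
          smul_add]
        rw [smul_comm a c, ← integral_smul]
        congr 2
        funext s
        rw [smul_comm] }

end Operators

end SectorialCalculus

end

/-! A function of the Stieltjes algebra and the operator `Φ(f)` are the same integral of powers of
resolvents, taken for multiplication by `z` on `ℂ` and for `A` on `X`. Identities that use only the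
resolvent equation, boundedness and strong continuity are therefore proved once for an abstract
`IsResolventFamily`; `IsMixture` couples the scalar and the operator side.

Three facts make `Φ` usable. A product of resolvent powers is an average of resolvents to the total
power (`pow_mul_apply_eq_integral`), so products stay in the class. The Stieltjes transform is
injective (`integral_smul_eq_zero`), so the function determines the operator (`IsMixture.unique`).
Hence `Φ` is well defined and multiplicative, and `f_S(A)` does not depend on the regulariser
(`regularisedOp_eq`).

For `e(z) = (1 + z)⁻ⁿ`, splitting `μ` at `s = 1` writes `e f` with finite measures only and gives
`Φ(ef) = f̂(A)(1 + A)⁻ⁿ` (`IsBernsteinRep.isMixture`). So `f_S(A)` has the closed graph `{(x, y) :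
f̂(A)(1 + A)⁻ⁿ x = (1 + A)⁻ⁿ y}`, which contains the graph of `f̂(A)` since `f̂(A)` commutes with
resolvents. Conversely, `(1 + tA)⁻ⁿ` maps this closed graph into that of `f̂(A)` and tends strongly
to the identity as `t → 0`, because `dom A` is dense. -/

noncomputable section

namespace SectorialCalculus

/-! ### Resolvent families -/

/-- The algebraic and topological properties of the family `s ↦ (1 + s A)⁻¹` of a sectorial
operator. -/
structure IsResolventFamily {X : Type*} [NormedAddCommGroup X] [NormedSpace ℂ X]
    (r : ℝ≥0 → X →L[ℂ] X) : Prop where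
  apply_zero : r 0 = 1
  exists_bound : ∃ M : ℝ, ∀ s, ‖r s‖ ≤ M
  continuous_apply : ∀ x, Continuous fun s => r s x
  resolvent_eq : ∀ s t : ℝ≥0, ((s : ℝ) : ℂ) • r s - ((t : ℝ) : ℂ) • r t
    = (((s : ℝ) : ℂ) - ((t : ℝ) : ℂ)) • (r s * r t)

namespace IsResolventFamily

variable {X : Type*} [NormedAddCommGroup X] [NormedSpace ℂ X] {r : ℝ≥0 → X →L[ℂ] X}

theorem commute (hr : IsResolventFamily r) (s t : ℝ≥0) : Commute (r s) (r t) := by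
  rcases eq_or_ne s t with rfl | hst
  · exact Commute.refl _
  have h1 := hr.resolvent_eq s t
  have h2 := hr.resolvent_eq t s
  have h0 : (((s : ℝ) : ℂ) - ((t : ℝ) : ℂ)) ≠ 0 := by
    rw [sub_ne_zero]
    exact_mod_cast hst
  have h3 : (((s : ℝ) : ℂ) - ((t : ℝ) : ℂ)) • (r s * r t)
      = (((s : ℝ) : ℂ) - ((t : ℝ) : ℂ)) • (r t * r s) := by
    rw [← h1, ← neg_sub ((t : ℝ) : ℂ), neg_smul, ← h2, neg_sub]
  exact smul_right_injective _ h0 h3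

theorem exists_nonneg_bound (hr : IsResolventFamily r) : ∃ M : ℝ, 0 ≤ M ∧ ∀ s, ‖r s‖ ≤ M := by
  obtain ⟨M, hM⟩ := hr.exists_bound
  exact ⟨M, (norm_nonneg _).trans (hM 0), hM⟩

theorem norm_pow_apply_le {M : ℝ} (hM : ∀ s, ‖r s‖ ≤ M) (n : ℕ) (s : ℝ≥0) (x : X) :
    ‖(r s ^ n) x‖ ≤ M ^ n * ‖x‖ := by
  have hM0 : 0 ≤ M := (norm_nonneg _).trans (hM 0)
  induction n with
  | zero => simp
  | succ n ih =>
    rw [pow_succ', mul_apply_eq_comp, pow_succ', mul_assoc]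
    exact (ContinuousLinearMap.le_opNorm _ _).trans (mul_le_mul (hM s) ih (norm_nonneg _) hM0)

/-- Norm continuity may fail at `s = 0`. Strong continuity and the uniform bound give joint
continuity, which lets powers be treated one factor at a time. -/
theorem continuous_uncurry (hr : IsResolventFamily r) :
    Continuous fun p : ℝ≥0 × X => r p.1 p.2 := by
  obtain ⟨M, hM0, hM⟩ := hr.exists_nonneg_bound
  refine continuous_iff_continuousAt.2 fun ⟨s, x⟩ => ?_
  rw [ContinuousAt, tendsto_iff_norm_sub_tendsto_zero]
  have h1 : Filter.Tendsto (fun p : ℝ≥0 × X => M * ‖p.2 - x‖ + ‖r p.1 x - r s x‖)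
      (nhds (s, x)) (nhds (M * ‖x - x‖ + ‖r s x - r s x‖)) := by
    have hc : Continuous fun p : ℝ≥0 × X => M * ‖p.2 - x‖ + ‖r p.1 x - r s x‖ := by
      have := (hr.continuous_apply x).comp (continuous_fst (X := ℝ≥0) (Y := X))
      exact (continuous_const.mul (continuous_snd.sub continuous_const).norm).add
        (this.sub continuous_const).norm
    exact hc.tendsto (s, x)
  simp only [sub_self, norm_zero, mul_zero, add_zero] at h1
  refine squeeze_zero (fun _ => norm_nonneg _) (fun p => ?_) h1
  calc ‖r p.1 p.2 - r s x‖ = ‖r p.1 (p.2 - x) + (r p.1 x - r s x)‖ := by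
        rw [map_sub]; abel_nf
    _ ≤ ‖r p.1 (p.2 - x)‖ + ‖r p.1 x - r s x‖ := norm_add_le _ _
    _ ≤ M * ‖p.2 - x‖ + ‖r p.1 x - r s x‖ := by
        gcongr
        exact (ContinuousLinearMap.le_opNorm _ _).trans (by gcongr; exact hM _)

theorem continuous_pow_apply (hr : IsResolventFamily r) (n : ℕ) {α : Type*} [TopologicalSpace α]
    {σ : α → ℝ≥0} {g : α → X} (hσ : Continuous σ) (hg : Continuous g) :
    Continuous fun a => (r (σ a) ^ n) (g a) := by
  induction n with
  | zero => simpa using hg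
  | succ n ih =>
    simp only [pow_succ', mul_apply_eq_comp]
    exact hr.continuous_uncurry.comp (hσ.prodMk ih)

theorem continuous_pow_mul_pow_apply (hr : IsResolventFamily r) (a b : ℕ) (x : X) :
    Continuous fun p : ℝ≥0 × ℝ≥0 => (r p.1 ^ a * r p.2 ^ b) x := by
  simp only [mul_apply_eq_comp]
  exact hr.continuous_pow_apply a continuous_fst
    (hr.continuous_pow_apply b continuous_snd continuous_const)

/-- The resolvent equation solved for the difference: the factor `s - t` is what yields norm
continuity and the derivative away from `0`. -/
theorem sub_eq (hr : IsResolventFamily r) (s : ℝ≥0) {t : ℝ≥0} (ht : t ≠ 0) :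
    r s - r t = (((s : ℝ) : ℂ) - ((t : ℝ) : ℂ)) • (((t : ℝ) : ℂ)⁻¹ • (r s * (r t - 1))) := by
  have ht' : ((t : ℝ) : ℂ) ≠ 0 := by exact_mod_cast ht
  have h := hr.resolvent_eq s t
  rw [smul_comm, eq_inv_smul_iff₀ ht', mul_sub, mul_one, smul_sub, smul_sub, ← h,
    sub_smul]
  abel

theorem continuousAt (hr : IsResolventFamily r) {t : ℝ≥0} (ht : t ≠ 0) : ContinuousAt r t := by
  obtain ⟨M, hM0, hM⟩ := hr.exists_nonneg_bound
  rw [ContinuousAt, tendsto_iff_norm_sub_tendsto_zero]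
  have hb : Filter.Tendsto (fun s : ℝ≥0 => |(s : ℝ) - t| * ((t : ℝ)⁻¹ * (M * ‖r t - 1‖)))
      (nhds t) (nhds 0) := by
    have : Continuous fun s : ℝ≥0 => |(s : ℝ) - t| * ((t : ℝ)⁻¹ * (M * ‖r t - 1‖)) := by fun_prop
    simpa using this.tendsto t
  refine squeeze_zero (fun _ => norm_nonneg _) (fun s => ?_) hb
  rw [hr.sub_eq s ht, norm_smul, norm_smul, norm_inv, ← Complex.ofReal_sub, Complex.norm_real,
    Complex.norm_real, Real.norm_eq_abs, Real.norm_eq_abs, abs_of_nonneg t.coe_nonneg]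
  gcongr
  exact (norm_mul_le _ _).trans (by gcongr; exact hM s)

/-- The derivative is `-A(1 + vA)⁻²`, written without `A` by means of `vA(1 + vA)⁻¹ = 1 - (1 +
vA)⁻¹`. -/
theorem hasDerivAt (hr : IsResolventFamily r) {v : ℝ} (hv : 0 < v) :
    HasDerivAt (fun u : ℝ => r u.toNNReal)
      ((v : ℂ)⁻¹ • (r v.toNNReal * (r v.toNNReal - 1))) v := by
  have hv0 : v.toNNReal ≠ 0 := by simpa using hv
  rw [hasDerivAt_iff_tendsto_slope]
  have hc : Filter.Tendsto (fun u : ℝ => (v : ℂ)⁻¹ • (r u.toNNReal * (r v.toNNReal - 1)))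
      (nhdsWithin v {v}ᶜ) (nhds ((v : ℂ)⁻¹ • (r v.toNNReal * (r v.toNNReal - 1)))) := by
    have h1 : ContinuousAt (fun u : ℝ => r u.toNNReal) v :=
      ContinuousAt.comp (f := Real.toNNReal) (hr.continuousAt hv0)
        continuous_real_toNNReal.continuousAt
    have h2 : ContinuousAt (fun u : ℝ => (v : ℂ)⁻¹ • (r u.toNNReal * (r v.toNNReal - 1))) v :=
      ((h1.mul continuousAt_const).const_smul (v : ℂ)⁻¹ :)
    exact h2.tendsto.mono_left nhdsWithin_le_nhds
  refine hc.congr' ?_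
  filter_upwards [self_mem_nhdsWithin, mem_nhdsWithin_of_mem_nhds (lt_mem_nhds hv)] with u hu hu0
  have huv : ((u - v : ℝ) : ℂ) ≠ 0 := by
    simpa [sub_eq_zero] using hu
  rw [slope_def_module, hr.sub_eq _ hv0, Real.coe_toNNReal u hu0.le, Real.coe_toNNReal v hv.le,
    ← Complex.ofReal_sub, ← Complex.coe_smul (u - v)⁻¹, smul_smul, Complex.ofReal_inv,
    inv_mul_cancel₀ huv, one_smul]

end IsResolventFamily

/-- The point `u s + (1 - u) t` of the half-line. -/
def mixPoint (s t : ℝ≥0) (u : ℝ) : ℝ≥0 := (u * s + (1 - u) * t).toNNReal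

theorem continuous_mixPoint : Continuous fun p : (ℝ≥0 × ℝ≥0) × ℝ => mixPoint p.1.1 p.1.2 p.2 := by
  unfold mixPoint
  exact continuous_real_toNNReal.comp (by fun_prop)

namespace IsResolventFamily

variable {X : Type*} [NormedAddCommGroup X] [NormedSpace ℂ X] {r : ℝ≥0 → X →L[ℂ] X}

/-- With `v = us + (1 - u)t`, the derivative of `u(1 + vA)⁻¹` is `(1 + vA - u(s - t)A)(1 + vA)⁻² =
(1 + tA)(1 + vA)⁻²`. The unbounded factor disappears after multiplication by `(1 + tA)⁻¹`. -/
theorem exists_hasDerivAt_mixPoint (hr : IsResolventFamily r) (s t : ℝ≥0) {u : ℝ} (hu0 : 0 < u)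
    (hu1 : u < 1) : ∃ D : X →L[ℂ] X,
      HasDerivAt (fun u : ℝ => (u : ℂ) • r (mixPoint s t u)) D u ∧
      Commute (r (mixPoint s t u)) D ∧
      D * r t = r (mixPoint s t u) * r (mixPoint s t u) := by
  have hs0 : (0 : ℝ) ≤ s := s.2
  have ht0 : (0 : ℝ) ≤ t := t.2
  have hid : HasDerivAt (fun u : ℝ => (u : ℂ)) 1 u := Complex.ofRealCLM.hasDerivAt
  have hnn : 0 ≤ u * s + (1 - u) * t := by
    have := mul_nonneg hu0.le hs0
    have := mul_nonneg (sub_nonneg.2 hu1.le) ht0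
    linarith
  rcases hnn.eq_or_lt with h0 | hpos
  -- At the point `0` the formula with `v⁻¹` is unavailable, but an interior `u` then forces `s = t
  -- = 0` and the family along the path is constant.
  · have h1 : u * s = 0 := by nlinarith [mul_nonneg hu0.le hs0, mul_nonneg (sub_nonneg.2 hu1.le) ht0]
    have h2 : (1 - u) * t = 0 := by linarith
    have hs : s = 0 := by
      have := (mul_eq_zero.1 h1).resolve_left hu0.ne'
      exact_mod_cast this
    have ht : t = 0 := by
      have := (mul_eq_zero.1 h2).resolve_left (by linarith)
      exact_mod_cast this
    subst hs ht
    have hm : ∀ u, mixPoint 0 0 u = 0 := fun u => by simp [mixPoint]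
    refine ⟨1, ?_, Commute.one_right _, ?_⟩
    · simp only [hm, hr.apply_zero]
      simpa using hid.smul_const (1 : X →L[ℂ] X)
    · simp [hm, hr.apply_zero]
  · set v : ℝ := u * s + (1 - u) * t with hv
    have hlin : HasDerivAt (fun u : ℝ => u * (s : ℝ) + (1 - u) * t) ((s : ℝ) - t) u := by
      have h1 := (hasDerivAt_id u).mul_const (s : ℝ)
      have h2 := ((hasDerivAt_id u).const_sub 1).mul_const (t : ℝ)
      exact (h1.add h2).congr_deriv (by ring)
    have hR : HasDerivAt (fun u : ℝ => r (mixPoint s t u))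
        (((s : ℝ) - t) • ((v : ℂ)⁻¹ • (r v.toNNReal * (r v.toNNReal - 1)))) u :=
      HasDerivAt.scomp u (hr.hasDerivAt hpos) hlin
    have hv0 : (v : ℂ) ≠ 0 := by exact_mod_cast hpos.ne'
    have hc : Commute (r v.toNNReal) (r v.toNNReal * (r v.toNNReal - 1)) :=
      (Commute.refl _).mul_right ((Commute.refl _).sub_right (Commute.one_right _))
    have hm : mixPoint s t u = v.toNNReal := rfl
    refine ⟨_, hid.smul hR, ?_, ?_⟩
    · rw [hm]
      refine Commute.add_right (Commute.smul_right (Commute.smul_right (Commute.smul_right hc _) _) _)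
        (Commute.smul_right (Commute.refl _) _)
    · rw [hm]
      have key := hr.resolvent_eq v.toNNReal t
      rw [Real.coe_toNNReal v hpos.le] at key
      set R := r v.toNNReal
      have hvt : (u : ℂ) * (((s : ℝ) - t : ℝ) : ℂ) = (v : ℂ) - ((t : ℝ) : ℂ) := by
        rw [hv]; push_cast; ring
      rw [← Complex.coe_smul ((s : ℝ) - t), smul_smul, one_smul, hvt, add_mul]
      refine smul_right_injective _ hv0 ?_
      simp only [smul_add, smul_mul_assoc]
      rw [smul_comm ((v : ℂ) - _), smul_inv_smul₀ hv0]
      have e1 : ((v : ℂ) - ((t : ℝ) : ℂ)) • (R * (R - 1) * r t)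
          = R * ((v : ℂ) • R - ((t : ℝ) : ℂ) • r t) - ((v : ℂ) • R - ((t : ℝ) : ℂ) • r t) := by
        rw [key]
        simp only [mul_sub, sub_mul, mul_one, mul_smul_comm, smul_sub, mul_assoc]
      have e2 : (v : ℂ) • (R * r t) = ((v : ℂ) • R - ((t : ℝ) : ℂ) • r t)
          + ((t : ℝ) : ℂ) • (R * r t) := by
        rw [key, sub_smul]; abel
      rw [e1, e2]
      simp only [mul_sub, mul_smul_comm]
      abel

/-- A product of resolvents as a mixture of powers of resolvents:
`(1 + s A)⁻¹⁻ᵐ (1 + t A)⁻¹ = ∫₀¹ (m + 1) uᵐ (1 + (u s + (1 - u) t) A)⁻²⁻ᵐ du`. -/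
theorem pow_mul_apply_eq_integral [CompleteSpace X] (hr : IsResolventFamily r) (s t : ℝ≥0) (m : ℕ)
    (x : X) : (r s ^ (m + 1) * r t) x
      = ∫ u in (0 : ℝ)..1, (((m + 1) * u ^ m : ℝ) : ℂ) • (r (mixPoint s t u) ^ (m + 2)) x := by
  have hmix : Continuous fun u : ℝ => mixPoint s t u :=
    continuous_mixPoint.comp (by fun_prop : Continuous fun u : ℝ => ((s, t), u))
  have hcont : Continuous fun u : ℝ =>
      ((u ^ (m + 1) : ℝ) : ℂ) • (r (mixPoint s t u) ^ (m + 1)) (r t x) :=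
    (Complex.continuous_ofReal.comp (by fun_prop)).smul
      (hr.continuous_pow_apply _ hmix continuous_const)
  have hcont' : Continuous fun u : ℝ =>
      (((m + 1) * u ^ m : ℝ) : ℂ) • (r (mixPoint s t u) ^ (m + 2)) x :=
    (Complex.continuous_ofReal.comp (by fun_prop)).smul
      (hr.continuous_pow_apply _ hmix continuous_const)
  -- The primitive is `uᵐ⁺¹ (1 + vA)⁻ᵐ⁻¹ (1 + tA)⁻¹ x`: it vanishes at `u = 0` and is the left-hand
  -- side at `u = 1`. Strong continuity suffices at the endpoints.
  rw [intervalIntegral.integral_eq_sub_of_hasDerivAt_of_le zero_le_one hcont.continuousOn ?_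
    (hcont'.intervalIntegrable _ _)]
  · simp [mixPoint]
  · rintro u ⟨hu0, hu1⟩
    obtain ⟨D, hD, hcomm, hDt⟩ := hr.exists_hasDerivAt_mixPoint s t hu0 hu1
    have hpow := ((ContinuousLinearMap.apply ℂ X (r t x)).restrictScalars ℝ).hasFDerivAt.comp_hasDerivAt
      u (hD.fun_pow' (m + 1))
    set R := r (mixPoint s t u) with hR
    have hf : ((ContinuousLinearMap.apply ℂ X (r t x)).restrictScalars ℝ) ∘
        (fun u : ℝ => ((u : ℂ) • r (mixPoint s t u)) ^ (m + 1))
        = fun u : ℝ => ((u ^ (m + 1) : ℝ) : ℂ) • (r (mixPoint s t u) ^ (m + 1)) (r t x) := by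
      funext u
      rw [Function.comp_apply, smul_pow, Complex.ofReal_pow]
      rfl
    rw [hf] at hpow
    refine hpow.congr_deriv ?_
    -- The derivative of a power in a noncommutative algebra is a sum of `m + 1` products; they
    -- coincide since `D` commutes with `R`.
    have e : ∀ i ∈ Finset.range (m + 1),
        ((u : ℂ) • R) ^ ((m + 1).pred - i) * D * ((u : ℂ) • R) ^ i
          = ((u : ℂ) ^ m) • (R ^ m * D) := by
      intro i hi
      have hi' : i ≤ m := Nat.lt_succ_iff.1 (Finset.mem_range.1 hi)
      have hc : Commute (((u : ℂ) • R) ^ i) D := (hcomm.smul_left _).pow_left i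
      rw [mul_assoc, ← hc.eq, ← mul_assoc, ← pow_add, Nat.pred_succ, Nat.sub_add_cancel hi',
        smul_pow, smul_mul_assoc]
    rw [Finset.sum_congr rfl e, Finset.sum_const, Finset.card_range, ← Nat.cast_smul_eq_nsmul ℂ,
      smul_smul]
    change (((m + 1 : ℕ) : ℂ) * (u : ℂ) ^ m) • (R ^ m * D) (r t x) = _
    rw [← mul_apply_eq_comp, mul_assoc, hDt, ← mul_assoc, ← pow_succ,
      ← pow_succ]
    push_cast
    rfl

end IsResolventFamily

/-! ### The kernels `(1 + z s)⁻ᵐ` -/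

/-- With `θ = s / (1 + s)`, the quotient `(1 + zs) / (1 + s)` is the point `(1 - θ) + θz` of the
segment from `1` to `z`. The cut plane is star-shaped about `1`, so this never vanishes, and
compactness in `z` and `θ` gives a uniform lower bound. -/
theorem exists_le_norm_one_add_mul {z₀ : ℂ} (hz₀ : z₀ ∈ Complex.slitPlane) :
    ∃ c > 0, ∃ ε > 0, Metric.ball z₀ ε ⊆ Complex.slitPlane ∧
      ∀ z ∈ Metric.ball z₀ ε, ∀ s : ℝ≥0, c * (1 + (s : ℝ)) ≤ ‖1 + z * ((s : ℝ) : ℂ)‖ := by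
  obtain ⟨ε, hε, hball⟩ :=
    Metric.nhds_basis_closedBall.mem_iff.1 (Complex.isOpen_slitPlane.mem_nhds hz₀)
  have hK : IsCompact (Metric.closedBall z₀ ε ×ˢ Set.Icc (0 : ℝ) 1) :=
    (isCompact_closedBall z₀ ε).prod isCompact_Icc
  have hne : (Metric.closedBall z₀ ε ×ˢ Set.Icc (0 : ℝ) 1).Nonempty :=
    ⟨(z₀, 0), Metric.mem_closedBall_self hε.le, by simp⟩
  have hcont : Continuous fun p : ℂ × ℝ => ‖(1 - (p.2 : ℂ)) + (p.2 : ℂ) * p.1‖ := by fun_prop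
  obtain ⟨p, hp, hmin⟩ := hK.exists_isMinOn hne hcont.continuousOn
  have hpos : 0 < ‖(1 - (p.2 : ℂ)) + (p.2 : ℂ) * p.1‖ := by
    rw [norm_pos_iff]
    refine Complex.slitPlane_ne_zero ?_
    have := Complex.starConvex_one_slitPlane (hball hp.1)
      (sub_nonneg.2 hp.2.2) hp.2.1 (sub_add_cancel 1 p.2)
    simpa using this
  refine ⟨_, hpos, ε, hε, Metric.ball_subset_closedBall.trans hball, fun z hz s => ?_⟩
  have hs : (0 : ℝ) < 1 + s := by positivity
  have hmem : (z, (s : ℝ) / (1 + s)) ∈ Metric.closedBall z₀ ε ×ˢ Set.Icc (0 : ℝ) 1 := by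
    refine ⟨Metric.ball_subset_closedBall hz, by positivity, ?_⟩
    rw [div_le_one hs]
    linarith
  have h := isMinOn_iff.1 hmin _ hmem
  have e : (1 - (((s : ℝ) / (1 + s) : ℝ) : ℂ)) + (((s : ℝ) / (1 + s) : ℝ) : ℂ) * z
      = (1 + z * ((s : ℝ) : ℂ)) / ((1 + s : ℝ) : ℂ) := by
    have : ((1 : ℂ) + ((s : ℝ) : ℂ)) ≠ 0 := by exact_mod_cast hs.ne'
    push_cast
    field_simp
    ring
  simp only [e, norm_div, Complex.norm_real, Real.norm_eq_abs, abs_of_pos hs] at h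
  rwa [le_div_iff₀ hs] at h

theorem one_add_mul_ne_zero {z : ℂ} (hz : z ∈ Complex.slitPlane) (s : ℝ≥0) :
    1 + z * ((s : ℝ) : ℂ) ≠ 0 := by
  obtain ⟨c, hc, ε, hε, -, h⟩ := exists_le_norm_one_add_mul hz
  have h1 := h z (Metric.mem_ball_self hε) s
  rw [← norm_pos_iff]
  exact lt_of_lt_of_le (by positivity) h1

theorem norm_pow_div_le {c : ℝ} (hc : 0 < c) {z : ℂ} {s : ℝ≥0}
    (h : c * (1 + (s : ℝ)) ≤ ‖1 + z * ((s : ℝ) : ℂ)‖) (m k : ℕ) :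
    ‖((s : ℝ) : ℂ) ^ k / (1 + z * ((s : ℝ) : ℂ)) ^ (m + k)‖ ≤ (c ^ (m + k))⁻¹ := by
  have hs : (0 : ℝ) < 1 + s := by positivity
  have h1 : (s : ℝ) ^ k ≤ (1 + (s : ℝ)) ^ (m + k) :=
    (pow_le_pow_left₀ s.2 (by simp : (s : ℝ) ≤ 1 + s) k).trans
      (pow_le_pow_right₀ (by simp) (Nat.le_add_left k m))
  rw [norm_div, norm_pow, norm_pow, Complex.norm_real, Real.norm_eq_abs, abs_of_nonneg s.coe_nonneg]
  calc (s : ℝ) ^ k / ‖1 + z * ((s : ℝ) : ℂ)‖ ^ (m + k)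
      ≤ (1 + (s : ℝ)) ^ (m + k) / (c * (1 + (s : ℝ))) ^ (m + k) := by gcongr
    _ = (c ^ (m + k))⁻¹ := by
      rw [mul_pow]
      field_simp

/-! ### Injectivity of the Stieltjes transform -/

section Kernel

variable {Ω : Type*} [MeasurableSpace Ω] {P : Measure Ω} {w : Ω → ℂ} {σ : Ω → ℝ≥0}

theorem integrable_mul_pow_div (hw : Integrable w P) (hσ : Measurable σ) (m k : ℕ) {z : ℂ}
    (hz : z ∈ Complex.slitPlane) :
    Integrable (fun ω => w ω * (((σ ω : ℝ) : ℂ) ^ k / (1 + z * ((σ ω : ℝ) : ℂ)) ^ (m + k))) P := by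
  obtain ⟨c, hc, ε, hε, -, h⟩ := exists_le_norm_one_add_mul hz
  refine (hw.norm.mul_const ((c ^ (m + k))⁻¹)).mono' ?_ (ae_of_all _ fun ω => ?_)
  · exact hw.aestronglyMeasurable.mul
      (Measurable.aestronglyMeasurable (by fun_prop))
  · rw [norm_mul]
    gcongr
    exact norm_pow_div_le hc (h z (Metric.mem_ball_self hε) _) m k

/-- Each derivative turns the index `k` into `k + 1` and keeps the kernel bounded in `s`, locally
uniformly in `z`, so dominated differentiation can be iterated. -/
theorem hasDerivAt_integral_pow_div (hw : Integrable w P) (hσ : Measurable σ) (m k : ℕ) {z : ℂ}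
    (hz : z ∈ Complex.slitPlane) :
    HasDerivAt
      (fun z => ∫ ω, w ω * (((σ ω : ℝ) : ℂ) ^ k / (1 + z * ((σ ω : ℝ) : ℂ)) ^ (m + k)) ∂P)
      (-((m + k : ℕ) : ℂ) * ∫ ω, w ω *
        (((σ ω : ℝ) : ℂ) ^ (k + 1) / (1 + z * ((σ ω : ℝ) : ℂ)) ^ (m + (k + 1))) ∂P) z := by
  obtain ⟨c, hc, ε, hε, hsub, h⟩ := exists_le_norm_one_add_mul hz
  rw [← integral_const_mul]
  refine (hasDerivAt_integral_of_dominated_loc_of_deriv_le (Metric.ball_mem_nhds z hε)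
    (F' := fun z ω => -((m + k : ℕ) : ℂ) * (w ω *
        (((σ ω : ℝ) : ℂ) ^ (k + 1) / (1 + z * ((σ ω : ℝ) : ℂ)) ^ (m + (k + 1)))))
    (bound := fun ω => (m + k : ℕ) * (‖w ω‖ * (c ^ (m + (k + 1)))⁻¹))
    ?_ (integrable_mul_pow_div hw hσ m k hz) ?_ ?_ ?_ ?_).2
  · filter_upwards [Complex.isOpen_slitPlane.mem_nhds hz] with y hy
    exact (integrable_mul_pow_div hw hσ m k hy).aestronglyMeasurable
  · exact ((integrable_mul_pow_div hw hσ m (k + 1) hz).const_mul _).aestronglyMeasurable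
  · refine ae_of_all _ fun ω y hy => ?_
    rw [norm_mul, norm_neg, Complex.norm_natCast, norm_mul]
    gcongr
    exact norm_pow_div_le hc (h y hy _) m (k + 1)
  · exact (hw.norm.mul_const _).const_mul _
  · refine ae_of_all _ fun ω y hy => ?_
    have hne := one_add_mul_ne_zero (hsub hy) (σ ω)
    have h1 : HasDerivAt (fun y : ℂ => 1 + y * ((σ ω : ℝ) : ℂ)) ((σ ω : ℝ) : ℂ) y := by
      simpa using ((hasDerivAt_id y).mul_const ((σ ω : ℝ) : ℂ)).const_add 1
    have h2 := (((h1.fun_pow (m + k)).fun_inv (pow_ne_zero _ hne)).const_mul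
      (((σ ω : ℝ) : ℂ) ^ k)).const_mul (w ω)
    simp only [← div_eq_mul_inv] at h2
    refine h2.congr_deriv ?_
    -- The power rule contains the truncated exponent `m + k - 1`, so the constant kernel is treated
    -- apart.
    rcases Nat.eq_zero_or_pos (m + k) with h0 | hpos
    · simp [h0]
    · obtain ⟨j, hj⟩ := Nat.exists_eq_add_of_lt hpos
      rw [← add_assoc m k 1, hj]
      simp only [zero_add, Nat.add_sub_cancel]
      field_simp
      ring

theorem differentiableOn_integral_one_div (hw : Integrable w P) (hσ : Measurable σ) (m : ℕ) :
    DifferentiableOn ℂ (fun z => ∫ ω, w ω * (1 / (1 + z * ((σ ω : ℝ) : ℂ)) ^ m) ∂P)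
      Complex.slitPlane := fun z hz => by
  have := hasDerivAt_integral_pow_div hw hσ m 0 hz
  simp only [pow_zero, add_zero] at this
  exact this.differentiableAt.differentiableWithinAt

/-- Differentiate the vanishing transform `k` times; `m ≥ 1` ensures that the factors `m + k` do not
vanish. -/
theorem integral_pow_div_eq_zero (hw : Integrable w P) (hσ : Measurable σ) {m : ℕ} (hm : 1 ≤ m)
    (h0 : ∀ z ∈ Complex.slitPlane, ∫ ω, w ω * (1 / (1 + z * ((σ ω : ℝ) : ℂ)) ^ m) ∂P = 0) (k : ℕ) :
    ∀ z ∈ Complex.slitPlane,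
      ∫ ω, w ω * (((σ ω : ℝ) : ℂ) ^ k / (1 + z * ((σ ω : ℝ) : ℂ)) ^ (m + k)) ∂P = 0 := by
  induction k with
  | zero => simpa using h0
  | succ k ih =>
    intro z hz
    have h1 := hasDerivAt_integral_pow_div hw hσ m k hz
    have h2 : HasDerivAt
        (fun z => ∫ ω, w ω * (((σ ω : ℝ) : ℂ) ^ k / (1 + z * ((σ ω : ℝ) : ℂ)) ^ (m + k)) ∂P)
        0 z := by
      refine (hasDerivAt_const z (0 : ℂ)).congr_of_eventuallyEq ?_
      filter_upwards [Complex.isOpen_slitPlane.mem_nhds hz] with y hy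
      exact ih y hy
    have h3 := h1.unique h2
    refine (mul_eq_zero.1 h3).resolve_left ?_
    rw [neg_eq_zero, Nat.cast_eq_zero]
    omega

theorem integrable_mul_polynomial (hw : Integrable w P) (hσ : Measurable σ) (m : ℕ)
    {g : ℝ → ℝ} (hg : Measurable g) {C : ℝ} (hC : ∀ u ∈ Set.Icc (0 : ℝ) 1, |g u| ≤ C) :
    Integrable (fun ω => w ω * (1 / (1 + ((σ ω : ℝ) : ℂ)) ^ m) *
      ((g ((σ ω : ℝ) / (1 + σ ω)) : ℝ) : ℂ)) P := by
  have h1 : Integrable (fun ω => w ω * (1 / (1 + ((σ ω : ℝ) : ℂ)) ^ m)) P := by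
    simpa using integrable_mul_pow_div hw hσ m 0 Complex.one_mem_slitPlane
  refine (h1.norm.mul_const C).mono' ?_ (ae_of_all _ fun ω => ?_)
  · refine h1.aestronglyMeasurable.mul (Measurable.aestronglyMeasurable ?_)
    exact Complex.measurable_ofReal.comp (hg.comp (by fun_prop))
  · rw [norm_mul, Complex.norm_real, Real.norm_eq_abs]
    gcongr
    refine hC _ ⟨by positivity, ?_⟩
    rw [div_le_one (by positivity)]
    linarith

/-- At `z = 1` the differentiated kernel is `(1 + s)⁻ᵐ (s / (1 + s))ᵏ`. In the variable `s / (1 +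
s)` of `[0, 1]`, all moments of the weighted measure therefore vanish. -/
theorem integral_mul_polynomial_eq_zero (hw : Integrable w P) (hσ : Measurable σ) {m : ℕ}
    (hm : 1 ≤ m)
    (h0 : ∀ z ∈ Complex.slitPlane, ∫ ω, w ω * (1 / (1 + z * ((σ ω : ℝ) : ℂ)) ^ m) ∂P = 0)
    (p : Polynomial ℝ) :
    ∫ ω, w ω * (1 / (1 + ((σ ω : ℝ) : ℂ)) ^ m) *
      ((p.eval ((σ ω : ℝ) / (1 + σ ω)) : ℝ) : ℂ) ∂P = 0 := by
  have hint : ∀ p : Polynomial ℝ, Integrable (fun ω => w ω * (1 / (1 + ((σ ω : ℝ) : ℂ)) ^ m) *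
      ((p.eval ((σ ω : ℝ) / (1 + σ ω)) : ℝ) : ℂ)) P := fun p => by
    obtain ⟨C, hC⟩ := isCompact_Icc.exists_bound_of_continuousOn (s := Set.Icc (0 : ℝ) 1)
      p.continuous.continuousOn
    exact integrable_mul_polynomial hw hσ m p.continuous.measurable hC
  induction p using Polynomial.induction_on' with
  | add p q hp hq =>
    simp only [Polynomial.eval_add, Complex.ofReal_add, mul_add]
    rw [integral_add (hint p) (hint q), hp, hq, add_zero]
  | monomial k b =>
    have h1 := integral_pow_div_eq_zero hw hσ hm h0 k 1 Complex.one_mem_slitPlane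
    have e : ∀ ω, w ω * (1 / (1 + ((σ ω : ℝ) : ℂ)) ^ m) *
        (((Polynomial.monomial k b).eval ((σ ω : ℝ) / (1 + σ ω)) : ℝ) : ℂ)
        = b * (w ω * (((σ ω : ℝ) : ℂ) ^ k / (1 + 1 * ((σ ω : ℝ) : ℂ)) ^ (m + k))) := fun ω => by
      rw [Polynomial.eval_monomial]
      push_cast
      rw [div_pow, pow_add, one_mul]
      simp only [div_eq_mul_inv, mul_inv]
      ring
    simp only [e]
    rw [integral_const_mul, h1, mul_zero]

theorem integral_mul_continuous_eq_zero (hw : Integrable w P) (hσ : Measurable σ) {m : ℕ}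
    (hm : 1 ≤ m)
    (h0 : ∀ z ∈ Complex.slitPlane, ∫ ω, w ω * (1 / (1 + z * ((σ ω : ℝ) : ℂ)) ^ m) ∂P = 0)
    {g : ℝ → ℝ} (hg : Continuous g) :
    ∫ ω, w ω * (1 / (1 + ((σ ω : ℝ) : ℂ)) ^ m) * ((g ((σ ω : ℝ) / (1 + σ ω)) : ℝ) : ℂ) ∂P = 0 := by
  have h1 : Integrable (fun ω => w ω * (1 / (1 + ((σ ω : ℝ) : ℂ)) ^ m)) P := by
    simpa using integrable_mul_pow_div hw hσ m 0 Complex.one_mem_slitPlane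
  have hbd : ∀ g : ℝ → ℝ, Continuous g → ∃ C, ∀ u ∈ Set.Icc (0 : ℝ) 1, |g u| ≤ C := fun g hg =>
    isCompact_Icc.exists_bound_of_continuousOn hg.continuousOn
  rw [← norm_le_zero_iff]
  refine le_of_forall_pos_le_add fun ε hε => ?_
  set I := ∫ ω, ‖w ω * (1 / (1 + ((σ ω : ℝ) : ℂ)) ^ m)‖ ∂P
  have hI : 0 ≤ I := integral_nonneg fun _ => norm_nonneg _
  -- Weierstrass approximation; the error is integrated against a weight of mass `I`, and `I + 1`
  -- avoids division by zero.
  obtain ⟨p, hp⟩ := exists_polynomial_near_of_continuousOn 0 1 g hg.continuousOn (ε / (I + 1))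
    (by positivity)
  obtain ⟨Cg, hCg⟩ := hbd g hg
  obtain ⟨Cp, hCp⟩ := hbd _ p.continuous
  have hz := integral_mul_polynomial_eq_zero hw hσ hm h0 p
  rw [← sub_zero (∫ ω, _ ∂P), ← hz, ← integral_sub
    (integrable_mul_polynomial hw hσ m hg.measurable hCg)
    (integrable_mul_polynomial hw hσ m p.continuous.measurable hCp), zero_add]
  calc _ ≤ ∫ ω, ‖w ω * (1 / (1 + ((σ ω : ℝ) : ℂ)) ^ m)‖ * (ε / (I + 1)) ∂P := by
        refine norm_integral_le_of_norm_le (h1.norm.mul_const _) (ae_of_all _ fun ω => ?_)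
        rw [← mul_sub, norm_mul, ← Complex.ofReal_sub, Complex.norm_real, Real.norm_eq_abs,
          abs_sub_comm]
        gcongr
        refine (hp _ ⟨by positivity, ?_⟩).le
        rw [div_le_one (by positivity)]
        linarith
    _ = I * (ε / (I + 1)) := integral_mul_const _ _
    _ ≤ ε := by
        rw [mul_div_assoc', div_le_iff₀ (by positivity)]
        nlinarith

/-- Injectivity of the Stieltjes transform, tested against real functions. -/
theorem integral_mul_ofReal_eq_zero (hw : Integrable w P) (hσ : Measurable σ) {m : ℕ}
    (hm : 1 ≤ m)
    (h0 : ∀ z ∈ Complex.slitPlane, ∫ ω, w ω * (1 / (1 + z * ((σ ω : ℝ) : ℂ)) ^ m) ∂P = 0)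
    {φ : ℝ≥0 → ℝ} (hφ : Continuous φ) {C : ℝ} (hC : ∀ s, |φ s| ≤ C) :
    ∫ ω, w ω * ((φ (σ ω) : ℝ) : ℂ) ∂P = 0 := by
  -- `φ` need not have a limit at infinity. The truncation `ψ N` equals `φ` for `s ≤ N`, is bounded
  -- by `C`, and has the form `(1 + s)⁻ᵐ g(s / (1 + s))` with `g` continuous.
  let ψ : ℕ → ℝ≥0 → ℝ := fun N s =>
    φ (min s N) * ((1 + min (s : ℝ) N) / (1 + s)) ^ m
  have hlim : Filter.Tendsto (fun N => ∫ ω, w ω * ((ψ N (σ ω) : ℝ) : ℂ) ∂P) Filter.atTop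
      (nhds (∫ ω, w ω * ((φ (σ ω) : ℝ) : ℂ) ∂P)) := by
    refine tendsto_integral_of_dominated_convergence (fun ω => ‖w ω‖ * C) (fun N => ?_)
      (hw.norm.mul_const _) (fun N => ae_of_all _ fun ω => ?_) (ae_of_all _ fun ω => ?_)
    · refine hw.aestronglyMeasurable.mul (Measurable.aestronglyMeasurable ?_)
      have : Measurable (ψ N) := by
        have := hφ.measurable
        fun_prop
      exact Complex.measurable_ofReal.comp (this.comp hσ)
    · have hC0 : 0 ≤ C := (abs_nonneg _).trans (hC 0)
      rw [norm_mul, Complex.norm_real, Real.norm_eq_abs, abs_mul]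
      gcongr
      have h1 : |((1 + min (σ ω : ℝ) N) / (1 + σ ω)) ^ m| ≤ 1 := by
        rw [abs_of_nonneg (by positivity)]
        refine pow_le_one₀ (by positivity) ?_
        rw [div_le_one (by positivity)]
        gcongr
        exact min_le_left _ _
      calc _ ≤ C * 1 := mul_le_mul (hC _) h1 (abs_nonneg _) hC0
        _ = C := mul_one C
    · refine tendsto_const_nhds.congr' ?_
      obtain ⟨N₀, hN₀⟩ := exists_nat_ge (σ ω)
      filter_upwards [Filter.eventually_ge_atTop N₀] with N hN
      have h1 : σ ω ≤ N := hN₀.trans (by exact_mod_cast hN)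
      have h2 : (σ ω : ℝ) ≤ N := by exact_mod_cast h1
      have h3 : (1 + (σ ω : ℝ)) ≠ 0 := by positivity
      simp only [ψ, min_eq_left h1, min_eq_left h2, div_self h3, one_pow, mul_one]
  refine tendsto_nhds_unique hlim ?_
  refine tendsto_const_nhds.congr fun N => ?_
  -- For `u = s / (1 + s)` this is the image of `min s N` under the same map, so `v / (1 - v) = min
  -- s N` and `1 / (1 - v) = 1 + min s N`.
  let v : ℝ → ℝ := fun u => min u (N / (1 + N))
  have hv : ∀ u, 0 < 1 - v u := fun u => by
    have h1 : v u ≤ N / (1 + N) := min_le_right _ _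
    have h2 : (N : ℝ) / (1 + N) < 1 := by
      rw [div_lt_one (by positivity)]
      linarith
    linarith
  have hvc : Continuous v := by fun_prop
  have hgc : Continuous fun u : ℝ => φ (v u / (1 - v u)).toNNReal * (1 / (1 - v u)) ^ m := by
    have h1 : Continuous fun u : ℝ => 1 - v u := continuous_const.sub hvc
    exact (hφ.comp (continuous_real_toNNReal.comp (hvc.div h1 fun u => (hv u).ne'))).mul
      ((continuous_const.div h1 fun u => (hv u).ne').pow m)
  rw [← integral_mul_continuous_eq_zero hw hσ hm h0 hgc]
  refine integral_congr_ae (ae_of_all _ fun ω => ?_)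
  dsimp only
  generalize σ ω = s
  have hs : (0 : ℝ) < 1 + s := by positivity
  have hv' : v ((s : ℝ) / (1 + s)) = min (s : ℝ) N / (1 + min (s : ℝ) N) := by
    rcases le_total (s : ℝ) N with h | h
    · rw [min_eq_left h]
      refine min_eq_left ?_
      rw [div_le_div_iff₀ hs (by positivity)]
      nlinarith
    · rw [min_eq_right h]
      refine min_eq_right ?_
      rw [div_le_div_iff₀ (by positivity) hs]
      nlinarith
  have hmp : (0 : ℝ) < 1 + min (s : ℝ) N := by positivity
  have e1 : 1 - v ((s : ℝ) / (1 + s)) = 1 / (1 + min (s : ℝ) N) := by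
    rw [hv']
    field_simp
    ring
  have e2 : (v ((s : ℝ) / (1 + s)) / (1 - v ((s : ℝ) / (1 + s)))).toNNReal = min s N := by
    rw [e1, hv', div_div_div_cancel_right₀ hmp.ne', div_one]
    have : (min (s : ℝ) N) = ((min s N : ℝ≥0) : ℝ) := by simp
    rw [this, Real.toNNReal_coe]
  rw [e2, e1, one_div_one_div, mul_assoc]
  simp only [ψ]
  congr 1
  push_cast
  rw [div_pow]
  simp only [div_eq_mul_inv]
  ring

/-- Injectivity of the Stieltjes transform: a complex measure on `[0, ∞)` (here the image under
`σ` of the measure with density `w`) whose transform of order `m` vanishes is zero. -/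
theorem integral_smul_eq_zero {X : Type*} [NormedAddCommGroup X] [NormedSpace ℂ X]
    [CompleteSpace X] (hw : Integrable w P) (hσ : Measurable σ) {m : ℕ}
    (hm : 1 ≤ m)
    (h0 : ∀ z ∈ Complex.slitPlane, ∫ ω, w ω * (1 / (1 + z * ((σ ω : ℝ) : ℂ)) ^ m) ∂P = 0)
    {φ : ℝ≥0 → X} (hφ : Continuous φ) {C : ℝ} (hC : ∀ s, ‖φ s‖ ≤ C)
    (hint : Integrable (fun ω => w ω • φ (σ ω)) P) :
    ∫ ω, w ω • φ (σ ω) ∂P = 0 := by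
  -- Functionals separate points, and the real and imaginary parts of `ℓ ∘ φ` are bounded continuous
  -- test functions.
  refine SeparatingDual.eq_zero_of_forall_dual_eq_zero (R := ℂ) fun ℓ => ?_
  rw [← ℓ.integral_comp_comm hint]
  have hc : Continuous fun s => ℓ (φ s) := ℓ.continuous.comp hφ
  have hb : ∀ s, ‖ℓ (φ s)‖ ≤ ‖ℓ‖ * C := fun s =>
    (ℓ.le_opNorm _).trans (by gcongr; exact hC s)
  have hre := integral_mul_ofReal_eq_zero hw hσ hm h0 (Complex.continuous_re.comp hc)
    fun s => (Complex.abs_re_le_norm _).trans (hb s)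
  have him := integral_mul_ofReal_eq_zero hw hσ hm h0 (Complex.continuous_im.comp hc)
    fun s => (Complex.abs_im_le_norm _).trans (hb s)
  have hmeas : ∀ ψ : ℝ≥0 → ℝ, Continuous ψ → (∀ s, |ψ s| ≤ ‖ℓ‖ * C) →
      Integrable (fun ω => w ω * ((ψ (σ ω) : ℝ) : ℂ)) P := fun ψ hψ hb => by
    refine (hw.norm.mul_const (‖ℓ‖ * C)).mono' ?_ (ae_of_all _ fun ω => ?_)
    · exact hw.aestronglyMeasurable.mul (Measurable.aestronglyMeasurable
        (Complex.measurable_ofReal.comp (hψ.measurable.comp hσ)))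
    · rw [norm_mul, Complex.norm_real, Real.norm_eq_abs]
      gcongr
      exact hb _
  have e : ∀ ω, ℓ (w ω • φ (σ ω)) = w ω * (((ℓ (φ (σ ω))).re : ℝ) : ℂ)
      + w ω * (((ℓ (φ (σ ω))).im : ℝ) : ℂ) * Complex.I := fun ω => by
    rw [map_smul, smul_eq_mul, mul_assoc, ← mul_add, Complex.re_add_im]
  simp only [e]
  simp only [Function.comp_apply] at hre him
  rw [integral_add (hmeas (fun s => (ℓ (φ s)).re) (Complex.continuous_re.comp hc)
      fun s => (Complex.abs_re_le_norm _).trans (hb s))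
    ((hmeas (fun s => (ℓ (φ s)).im) (Complex.continuous_im.comp hc)
      fun s => (Complex.abs_im_le_norm _).trans (hb s)).mul_const _), integral_mul_const]
  rw [hre, him, zero_mul, add_zero]

end Kernel

/-! ### The resolvent families of complex numbers and of sectorial operators -/

/-- The resolvent family of the multiplication by `z` on `ℂ`. -/
def scalarFamily (z : ℂ) (s : ℝ≥0) : ℂ →L[ℂ] ℂ := (1 / (1 + z * ((s : ℝ) : ℂ))) • 1

theorem scalarFamily_pow_mul_pow_apply (z : ℂ) (s t : ℝ≥0) (a b : ℕ) :
    (scalarFamily z s ^ a * scalarFamily z t ^ b) 1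
      = 1 / (1 + z * ((s : ℝ) : ℂ)) ^ a * (1 / (1 + z * ((t : ℝ) : ℂ)) ^ b) := by
  simp [scalarFamily, smul_pow]
  ring

theorem isResolventFamily_scalarFamily {z : ℂ} (hz : z ∈ Complex.slitPlane) :
    IsResolventFamily (scalarFamily z) where
  apply_zero := by simp [scalarFamily]
  exists_bound := by
    obtain ⟨c, hc, ε, hε, -, h⟩ := exists_le_norm_one_add_mul hz
    refine ⟨c⁻¹, fun s => ?_⟩
    have := norm_pow_div_le hc (h z (Metric.mem_ball_self hε) s) 1 0
    rw [scalarFamily, norm_smul, norm_one, mul_one]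
    simpa using this
  continuous_apply x := by
    have : Continuous fun s : ℝ≥0 => 1 / (1 + z * ((s : ℝ) : ℂ)) :=
      continuous_const.div (by fun_prop) (one_add_mul_ne_zero hz)
    exact this.smul continuous_const
  resolvent_eq s t := by
    have hs := one_add_mul_ne_zero hz s
    have ht := one_add_mul_ne_zero hz t
    simp only [scalarFamily, smul_mul_smul_comm, mul_one, smul_smul, ← sub_smul]
    congr 1
    rw [mul_one_div, mul_one_div, div_sub_div _ _ hs ht, one_div_mul_one_div, mul_one_div]
    congr 1
    ring

variable {X : Type*} [NormedAddCommGroup X] [NormedSpace ℂ X] {A : X →ₗ.[ℂ] X}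

theorem IsSectorial.resolventOp_apply_add (hA : IsSectorial A) {s : ℝ≥0} (hs : 0 < s)
    (x : A.domain) : resolventOp A s x + ((s : ℝ) : ℂ) • resolventOp A s (A x) = x := by
  have h := (hA.isBoundedInverse hs).2 x
  have e : affineOp 1 ((s : ℝ) : ℂ) A x = (1 : ℂ) • (x : X) + ((s : ℝ) : ℂ) • A x := rfl
  rwa [e, one_smul, map_add, map_smul] at h

/-- The delicate point is strong continuity at `0`. For `y ∈ dom A` one has `(1 + tA)⁻¹y - y = -t(1
+ tA)⁻¹Ay → 0`; density and the uniform bound extend this to all vectors. -/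
theorem IsSectorial.isResolventFamily (hA : IsSectorial A) :
    IsResolventFamily (resolventOp A) where
  apply_zero := resolventOp_zero
  exists_bound := by
    obtain ⟨M, hM⟩ := hA.bounded_resolvent
    refine ⟨max M 1, fun s => ?_⟩
    rcases eq_or_lt_of_le (zero_le (a := s)) with rfl | hs
    · rw [resolventOp_zero]
      exact le_max_of_le_right ContinuousLinearMap.norm_id_le
    · exact le_max_of_le_left (hM s hs)
  continuous_apply x := by
    obtain ⟨M₀, hM₀⟩ := hA.bounded_resolvent
    set M := max M₀ 0
    have hM0 : 0 ≤ M := le_max_right _ _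
    have hM : ∀ s, 0 < s → ‖resolventOp A s‖ ≤ M := fun s hs => (hM₀ s hs).trans (le_max_left _ _)
    refine continuous_iff_continuousAt.2 fun s => ?_
    rcases eq_or_lt_of_le (zero_le (a := s)) with rfl | hs
    · rw [Metric.continuousAt_iff]
      intro ε hε
      -- Chosen so that `(M + 1)‖x - y‖ < ε / 2`; the radius in `t` below bounds the remaining term
      -- `t M ‖Ay‖` by `ε / 2`.
      obtain ⟨y, hy, hxy⟩ := Metric.mem_closure_iff.1 (hA.dense_domain x) (ε / (2 * (M + 1)))
        (by positivity)
      refine ⟨ε / (2 * (M * ‖A ⟨y, hy⟩‖ + 1)), by positivity, fun {t} ht => ?_⟩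
      rw [resolventOp_zero, one_apply_eq_self, dist_eq_norm]
      rcases eq_or_lt_of_le (zero_le (a := t)) with rfl | ht0
      · simpa [resolventOp_zero] using hε
      have htd : (t : ℝ) < ε / (2 * (M * ‖A ⟨y, hy⟩‖ + 1)) := by
        rw [NNReal.dist_eq, NNReal.coe_zero, sub_zero, abs_of_nonneg t.coe_nonneg] at ht
        exact ht
      have h1 := hA.resolventOp_apply_add ht0 ⟨y, hy⟩
      have h2 : resolventOp A t x - x
          = (resolventOp A t (x - y) - (x - y)) - ((t : ℝ) : ℂ) • resolventOp A t (A ⟨y, hy⟩) := by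
        simp only at h1
        rw [map_sub, eq_sub_of_add_eq h1]
        abel
      have hR : ∀ u, ‖resolventOp A t u‖ ≤ M * ‖u‖ := fun u =>
        (ContinuousLinearMap.le_opNorm _ _).trans (by gcongr; exact hM t ht0)
      rw [dist_eq_norm] at hxy
      calc ‖resolventOp A t x - x‖
          ≤ (M * ‖x - y‖ + ‖x - y‖) + t * (M * ‖A ⟨y, hy⟩‖) := by
            rw [h2]
            refine (norm_sub_le _ _).trans (add_le_add ((norm_sub_le _ _).trans ?_) ?_)
            · gcongr
              exact hR _
            · rw [norm_smul, Complex.norm_real, Real.norm_eq_abs, abs_of_nonneg t.coe_nonneg]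
              gcongr
              exact hR _
        _ < ε / 2 + ε / 2 := by
            refine add_lt_add_of_lt_of_le ?_ ?_
            · rw [lt_div_iff₀ (by positivity)] at hxy
              linarith
            · rw [lt_div_iff₀ (by positivity)] at htd
              linarith [t.coe_nonneg]
        _ = ε := add_halves ε
    · have h1 := (hA.continuousOn_resolventOp).continuousAt (Ioi_mem_nhds hs)
      exact h1.clm_apply continuousAt_const
  resolvent_eq s t := by
    rcases eq_or_lt_of_le (zero_le (a := s)) with rfl | hs
    · simp [resolventOp_zero]
    rcases eq_or_lt_of_le (zero_le (a := t)) with rfl | ht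
    · simp [resolventOp_zero]
    ext x
    obtain ⟨h, hx⟩ := hA.resolventOp_mem ht x
    -- The identity `(1 + sA)⁻¹(1 + sA) = 1` on the vector `(1 + tA)⁻¹x`, later multiplied by `t` to
    -- clear `t⁻¹`.
    have h1 := hA.resolventOp_apply_add hs ⟨resolventOp A t x, h⟩
    have ht0 : ((t : ℝ) : ℂ) ≠ 0 := by exact_mod_cast ht.ne'
    rw [hx, yosidaOp] at h1
    simp only [smul_apply, sub_apply, one_apply_eq_self, map_smul, map_sub] at h1
    have h2 := congrArg (fun v => ((t : ℝ) : ℂ) • v) h1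
    simp only [smul_add] at h2
    rw [smul_comm ((t : ℝ) : ℂ) ((s : ℝ) : ℂ), smul_inv_smul₀ ht0] at h2
    simp only [sub_apply, smul_apply, mul_apply_eq_comp, sub_smul]
    rw [← h2, smul_sub]
    abel

/-! ### Mixtures of powers of resolvents -/

section Mixture

variable {X : Type*} [NormedAddCommGroup X] [NormedSpace ℂ X] {r : ℝ≥0 → X →L[ℂ] X}
  {Ω : Type*} [MeasurableSpace Ω] {P : Measure Ω} {w : Ω → ℂ} {σ τ : Ω → ℝ≥0}

/-- The vector `∫ w(ω) (1 + σ(ω) A)⁻ᵃ (1 + τ(ω) A)⁻ᵇ x P(dω)`, for a general resolvent family. -/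
def mixture (r : ℝ≥0 → X →L[ℂ] X) (a b : ℕ) (P : Measure Ω) (w : Ω → ℂ) (σ τ : Ω → ℝ≥0)
    (x : X) : X :=
  ∫ ω, w ω • (r (σ ω) ^ a * r (τ ω) ^ b) x ∂P

theorem IsResolventFamily.integrable_mixture (hr : IsResolventFamily r) (a b : ℕ)
    (hw : Integrable w P) (hσ : Measurable σ) (hτ : Measurable τ) (x : X) :
    Integrable (fun ω => w ω • (r (σ ω) ^ a * r (τ ω) ^ b) x) P := by
  obtain ⟨M, hM0, hM⟩ := hr.exists_nonneg_bound
  refine (hw.norm.mul_const (M ^ a * (M ^ b * ‖x‖))).mono' ?_ (ae_of_all _ fun ω => ?_)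
  · refine hw.aestronglyMeasurable.smul (StronglyMeasurable.aestronglyMeasurable ?_)
    exact (hr.continuous_pow_mul_pow_apply a b x).stronglyMeasurable.comp_measurable
      (hσ.prodMk hτ)
  · rw [norm_smul, mul_apply_eq_comp]
    gcongr
    exact (IsResolventFamily.norm_pow_apply_le hM a _ _).trans
      (by gcongr; exact IsResolventFamily.norm_pow_apply_le hM b _ _)

/-- The averaging formula is applied at each `ω`, and its variable `u` becomes a further coordinate
of the parameter space. One power moves from `τ` to `σ`; the total order is unchanged. -/
theorem IsResolventFamily.mixture_shift [CompleteSpace X] [SFinite P] (hr : IsResolventFamily r)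
    (a b : ℕ) (hw : Integrable w P) (hσ : Measurable σ) (hτ : Measurable τ) (x : X) :
    mixture r (a + 1) (b + 1) P w σ τ x
      = mixture r (a + 2) b (P.prod (volume.restrict (Set.Ioc (0 : ℝ) 1)))
        (fun p => w p.1 * (((a + 1) * p.2 ^ a : ℝ) : ℂ)) (fun p => mixPoint (σ p.1) (τ p.1) p.2)
        (fun p => τ p.1) x := by
  have hmix : Measurable fun p : Ω × ℝ => mixPoint (σ p.1) (τ p.1) p.2 :=
    continuous_mixPoint.measurable.comp
      (((hσ.comp measurable_fst).prodMk (hτ.comp measurable_fst)).prodMk measurable_snd)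
  have hint : Integrable (fun u : ℝ => (((a + 1) * u ^ a : ℝ) : ℂ))
      (volume.restrict (Set.Ioc (0 : ℝ) 1)) := by
    have : Continuous fun u : ℝ => (((a + 1) * u ^ a : ℝ) : ℂ) := by fun_prop
    exact (this.intervalIntegrable 0 1).1
  have hI := hr.integrable_mixture (a + 2) b (hw.mul_prod hint) hmix (hτ.comp measurable_fst) x
  simp only [Function.comp_apply] at hI
  rw [mixture, mixture, integral_prod _ hI]
  refine integral_congr_ae (ae_of_all _ fun ω => ?_)
  simp only [mul_smul]
  rw [integral_smul]
  congr 1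
  have h := hr.pow_mul_apply_eq_integral (σ ω) (τ ω) a ((r (τ ω) ^ b) x)
  rw [intervalIntegral.integral_of_le zero_le_one] at h
  rw [pow_succ' (r (τ ω)), ← mul_assoc]
  exact h

theorem IsResolventFamily.mixture_prod [CompleteSpace X] (hr : IsResolventFamily r)
    {Ω' : Type*} [MeasurableSpace Ω'] {Q : Measure Ω'} [SFinite P] [SFinite Q] {v : Ω' → ℂ}
    {ρ κ : Ω' → ℝ≥0} (a b : ℕ) (hw : Integrable w P) (hσ : Measurable σ) (hv : Integrable v Q)
    (hρ : Measurable ρ) (x : X) (hκ : Measurable κ) :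
    mixture r a 0 P w σ τ (mixture r b 0 Q v ρ κ x)
      = mixture r a b (P.prod Q) (fun p => w p.1 * v p.2) (fun p => σ p.1) (fun p => ρ p.2) x := by
  have hI := hr.integrable_mixture a b (hw.mul_prod hv) (hσ.comp measurable_fst)
    (hρ.comp measurable_snd) x
  simp only [Function.comp_apply] at hI
  simp only [mixture]
  rw [integral_prod _ hI]
  refine integral_congr_ae (ae_of_all _ fun ω => ?_)
  have h := hr.integrable_mixture b 0 hv hρ hκ x
  simp only [mul_smul, pow_zero, mul_one] at h ⊢
  rw [integral_smul, ← ContinuousLinearMap.integral_comp_comm _ h]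
  congr 1
  refine integral_congr_ae (ae_of_all _ fun ω' => ?_)
  simp only [map_smul, mul_apply_eq_comp]

/-- Operators on `ℂ` are multiplications: this turns composition of scalar mixtures into
multiplication of functions. -/
theorem mixture_scalarFamily_mul (z : ℂ) (a b : ℕ) (y : ℂ) :
    mixture (scalarFamily z) a b P w σ τ y = mixture (scalarFamily z) a b P w σ τ 1 * y := by
  simp only [mixture]
  rw [← integral_mul_const]
  refine integral_congr_ae (ae_of_all _ fun ω => ?_)
  have : y = y • (1 : ℂ) := by simp
  dsimp only
  conv_lhs => rw [this, map_smul]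
  simp only [smul_eq_mul]
  ring

theorem mixture_scalarFamily_zero (z : ℂ) (a : ℕ) :
    mixture (scalarFamily z) a 0 P w σ τ 1
      = ∫ ω, w ω * (1 / (1 + z * ((σ ω : ℝ) : ℂ)) ^ a) ∂P := by
  simp only [mixture, scalarFamily_pow_mul_pow_apply, smul_eq_mul]
  simp only [pow_zero, div_one, mul_one]

/-- `f(z) = ∫ w (1 + σ z)⁻ᵃ (1 + τ z)⁻ᵇ dP` on the cut plane, and `T x` is the same mixture for the
resolvent family `r`. -/
def IsMixture (r : ℝ≥0 → X →L[ℂ] X) (a b : ℕ) (f : ℂ → ℂ) (T : X → X) : Prop :=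
  ∃ (Ω : Type) (_ : MeasurableSpace Ω) (P : Measure Ω) (w : Ω → ℂ) (σ τ : Ω → ℝ≥0),
    IsFiniteMeasure P ∧ Integrable w P ∧ Measurable σ ∧ Measurable τ ∧
    (∀ z ∈ Complex.slitPlane, f z = mixture (scalarFamily z) a b P w σ τ 1) ∧
    ∀ x, T x = mixture r a b P w σ τ x

namespace IsMixture

variable {a b : ℕ} {f g : ℂ → ℂ} {T S : X → X}

theorem congr (h : IsMixture r a b f T) (hfg : ∀ z ∈ Complex.slitPlane, g z = f z)
    (hTS : ∀ x, S x = T x) : IsMixture r a b g S := by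
  obtain ⟨Ω, _, P, w, σ, τ, hP, hw, hσ, hτ, hf, hT⟩ := h
  exact ⟨Ω, _, P, w, σ, τ, hP, hw, hσ, hτ, fun z hz => (hfg z hz).trans (hf z hz),
    fun x => (hTS x).trans (hT x)⟩

theorem shift [CompleteSpace X] (hr : IsResolventFamily r) (h : IsMixture r (a + 1) (b + 1) f T) :
    IsMixture r (a + 2) b f T := by
  obtain ⟨Ω, _, P, w, σ, τ, hP, hw, hσ, hτ, hf, hT⟩ := h
  have hint : Integrable (fun u : ℝ => (((a + 1) * u ^ a : ℝ) : ℂ))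
      (volume.restrict (Set.Ioc (0 : ℝ) 1)) := by
    have : Continuous fun u : ℝ => (((a + 1) * u ^ a : ℝ) : ℂ) := by fun_prop
    exact (this.intervalIntegrable 0 1).1
  have hmix : Measurable fun p : Ω × ℝ => mixPoint (σ p.1) (τ p.1) p.2 :=
    continuous_mixPoint.measurable.comp
      (((hσ.comp measurable_fst).prodMk (hτ.comp measurable_fst)).prodMk measurable_snd)
  exact ⟨Ω × ℝ, inferInstance, P.prod (volume.restrict (Set.Ioc (0 : ℝ) 1)), _, _, _,
    inferInstance, hw.mul_prod hint, hmix, hτ.comp measurable_fst,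
    fun z hz => (hf z hz).trans
      ((isResolventFamily_scalarFamily hz).mixture_shift a b hw hσ hτ 1),
    fun x => (hT x).trans (hr.mixture_shift a b hw hσ hτ x)⟩

/-- Repeated shifts empty the second factor. The averaging formula needs at least one factor at `σ`,
whence `1 ≤ a`. -/
theorem collapse [CompleteSpace X] (hr : IsResolventFamily r) (ha : 1 ≤ a)
    (h : IsMixture r a b f T) : IsMixture r (a + b) 0 f T := by
  induction b generalizing a with
  | zero => exact h
  | succ b ih =>
    obtain ⟨a, rfl⟩ := Nat.exists_eq_add_of_le' ha
    have := ih (by omega) (h.shift hr)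
    rwa [show a + 1 + (b + 1) = a + 2 + b by omega]

theorem extend (hr : IsResolventFamily r) (h : IsMixture r a 0 f T) (k : ℕ) :
    IsMixture r a k f T := by
  obtain ⟨Ω, _, P, w, σ, τ, hP, hw, hσ, hτ, hf, hT⟩ := h
  refine ⟨Ω, _, P, w, σ, fun _ => 0, hP, hw, hσ, measurable_const, fun z hz => ?_, fun x => ?_⟩
  · rw [hf z hz, mixture, mixture]
    simp only [(isResolventFamily_scalarFamily hz).apply_zero, one_pow, pow_zero]
  · rw [hT x, mixture, mixture]
    simp only [hr.apply_zero, one_pow, pow_zero]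

/-- Factors `(1 + 0·A)⁻ᵏ = 1` are inserted at no cost and then absorbed, which brings
representations of different orders to a common one. -/
theorem raise [CompleteSpace X] (hr : IsResolventFamily r) (ha : 1 ≤ a)
    (h : IsMixture r a 0 f T) (k : ℕ) : IsMixture r (a + k) 0 f T :=
  (h.extend hr k).collapse hr ha

theorem comp [CompleteSpace X] (hr : IsResolventFamily r) (h : IsMixture r a 0 f T)
    (h' : IsMixture r b 0 g S) : IsMixture r a b (fun z => f z * g z) (fun x => T (S x)) := by
  obtain ⟨Ω, _, P, w, σ, τ, hP, hw, hσ, hτ, hf, hT⟩ := h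
  obtain ⟨Ω', _, Q, v, ρ, κ, hQ, hv, hρ, hκ, hg, hS⟩ := h'
  refine ⟨Ω × Ω', inferInstance, P.prod Q, fun p => w p.1 * v p.2, fun p => σ p.1,
    fun p => ρ p.2, inferInstance, hw.mul_prod hv, hσ.comp measurable_fst,
    hρ.comp measurable_snd, fun z hz => ?_, fun x => ?_⟩
  · beta_reduce
    rw [hf z hz, hg z hz, ← mixture_scalarFamily_mul,
      (isResolventFamily_scalarFamily hz).mixture_prod a b hw hσ hv hρ 1 hκ]
  · beta_reduce
    rw [hS, hT, hr.mixture_prod a b hw hσ hv hρ x hκ]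

theorem smul (h : IsMixture r a b f T) (c : ℂ) :
    IsMixture r a b (fun z => c * f z) (fun x => c • T x) := by
  obtain ⟨Ω, _, P, w, σ, τ, hP, hw, hσ, hτ, hf, hT⟩ := h
  refine ⟨Ω, _, P, fun ω => c * w ω, σ, τ, hP, hw.const_mul c, hσ, hτ, fun z hz => ?_,
    fun x => ?_⟩
  · beta_reduce
    rw [hf z hz, mixture, mixture, ← integral_const_mul]
    simp only [smul_eq_mul, mul_assoc]
  · beta_reduce
    rw [hT x, mixture, mixture, ← integral_smul]
    simp only [mul_smul]

/-- Sums of mixtures are mixtures over the disjoint union of the parameter spaces. -/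
theorem _root_.SectorialCalculus.integral_map_inl_add_map_inr {Ω Ω' E : Type*} [MeasurableSpace Ω]
    [MeasurableSpace Ω'] [NormedAddCommGroup E] [NormedSpace ℝ E] {P : Measure Ω} {Q : Measure Ω'}
    {g : Ω → E} {g' : Ω' → E} (hg : Integrable g P) (hg' : Integrable g' Q) :
    Integrable (Sum.elim g g') (P.map Sum.inl + Q.map Sum.inr) ∧
      ∫ ω, Sum.elim g g' ω ∂(P.map Sum.inl + Q.map Sum.inr) = ∫ ω, g ω ∂P + ∫ ω, g' ω ∂Q := by
  have hl : MeasurableEmbedding (Sum.inl : Ω → Ω ⊕ Ω') :=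
    ⟨Sum.inl_injective, measurable_inl, fun _ hs => measurableSet_inl_image.2 hs⟩
  have hr : MeasurableEmbedding (Sum.inr : Ω' → Ω ⊕ Ω') :=
    ⟨Sum.inr_injective, measurable_inr, fun _ hs => measurableSet_inr_image.2 hs⟩
  have h1 : Integrable (Sum.elim g g') (P.map Sum.inl) := hl.integrable_map_iff.2 hg
  have h2 : Integrable (Sum.elim g g') (Q.map Sum.inr) := hr.integrable_map_iff.2 hg'
  refine ⟨integrable_add_measure.2 ⟨h1, h2⟩, ?_⟩
  rw [integral_add_measure h1 h2, hl.integral_map, hr.integral_map]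
  rfl

theorem _root_.SectorialCalculus.IsResolventFamily.mixture_add (hr : IsResolventFamily r)
    {Ω' : Type*} [MeasurableSpace Ω'] {Q : Measure Ω'} {v : Ω' → ℂ}
    {ρ κ : Ω' → ℝ≥0} (a b : ℕ) (hw : Integrable w P) (hσ : Measurable σ) (hτ : Measurable τ)
    (hv : Integrable v Q) (hρ : Measurable ρ) (hκ : Measurable κ) (x : X) :
    mixture r a b P w σ τ x + mixture r a b Q v ρ κ x
      = mixture r a b (P.map Sum.inl + Q.map Sum.inr) (Sum.elim w v) (Sum.elim σ ρ)
        (Sum.elim τ κ) x := by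
  simp only [mixture]
  rw [← (integral_map_inl_add_map_inr (hr.integrable_mixture a b hw hσ hτ x)
    (hr.integrable_mixture a b hv hρ hκ x)).2]
  refine integral_congr_ae (ae_of_all _ fun ω => ?_)
  cases ω <;> rfl

theorem add (hr : IsResolventFamily r) (h : IsMixture r a b f T) (h' : IsMixture r a b g S) :
    IsMixture r a b (fun z => f z + g z) (fun x => T x + S x) := by
  obtain ⟨Ω, _, P, w, σ, τ, hP, hw, hσ, hτ, hf, hT⟩ := h
  obtain ⟨Ω', _, Q, v, ρ, κ, hQ, hv, hρ, hκ, hg, hS⟩ := h'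
  refine ⟨Ω ⊕ Ω', inferInstance, P.map Sum.inl + Q.map Sum.inr, Sum.elim w v, Sum.elim σ ρ,
    Sum.elim τ κ, inferInstance, (integral_map_inl_add_map_inr hw hv).1, hσ.sumElim hρ,
    hτ.sumElim hκ, fun z hz => ?_, fun x => ?_⟩
  · beta_reduce
    rw [hf z hz, hg z hz,
      (isResolventFamily_scalarFamily hz).mixture_add a b hw hσ hτ hv hρ hκ 1]
  · beta_reduce
    rw [hT x, hS x, hr.mixture_add a b hw hσ hτ hv hρ hκ x]

theorem zero : IsMixture r a b (fun _ => 0) (fun _ => 0) :=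
  ⟨Unit, inferInstance, 0, fun _ => 0, fun _ => 0, fun _ => 0, inferInstance,
    integrable_zero _ _ _, measurable_const, measurable_const,
    fun z _ => by simp [mixture], fun x => by simp [mixture]⟩

theorem sum (hr : IsResolventFamily r) {ι : Type*} (s : Finset ι) {f : ι → ℂ → ℂ}
    {T : ι → X → X} (h : ∀ i ∈ s, IsMixture r a b (f i) (T i)) :
    IsMixture r a b (fun z => ∑ i ∈ s, f i z) (fun x => ∑ i ∈ s, T i x) := by
  classical
  induction s using Finset.induction_on with
  | empty => simpa using zero
  | insert i s hi ih =>
    have h1 := (h i (Finset.mem_insert_self i s)).add hr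
      (ih fun j hj => h j (Finset.mem_insert_of_mem hj))
    simpa only [Finset.sum_insert hi] using h1

/-- Injectivity of the transform, tested on the bounded continuous function `s ↦ r(s)ᵃ x`. -/
theorem eq_zero [CompleteSpace X] (hr : IsResolventFamily r) (ha : 1 ≤ a)
    (h : IsMixture r a 0 f T) (hf : ∀ z ∈ Complex.slitPlane, f z = 0) (x : X) : T x = 0 := by
  obtain ⟨Ω, _, P, w, σ, τ, hP, hw, hσ, hτ, hf', hT⟩ := h
  obtain ⟨M, hM0, hM⟩ := hr.exists_nonneg_bound
  have hint := hr.integrable_mixture a 0 hw hσ hτ x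
  rw [hT x, mixture]
  simp only [pow_zero, mul_one] at hint ⊢
  refine integral_smul_eq_zero hw hσ ha (fun z hz => ?_)
    (hr.continuous_pow_apply a continuous_id continuous_const)
    (IsResolventFamily.norm_pow_apply_le hM a · x) hint
  rw [← mixture_scalarFamily_zero (τ := τ), ← hf' z hz, hf z hz]

/-- Both mixtures are raised to order `a + b`; their difference has a vanishing transform. -/
theorem unique [CompleteSpace X] (hr : IsResolventFamily r) (ha : 1 ≤ a) (hb : 1 ≤ b)
    (h : IsMixture r a 0 f T) (h' : IsMixture r b 0 g S)
    (hfg : ∀ z ∈ Complex.slitPlane, f z = g z) (x : X) : T x = S x := by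
  have h1 := h.raise hr ha b
  have h2 := (h'.raise hr hb a).smul (-1)
  rw [add_comm b a] at h2
  have h3 := (h1.add hr h2).eq_zero hr (by omega) (fun z hz => by rw [hfg z hz]; ring) x
  rw [neg_one_smul, ← sub_eq_add_neg, sub_eq_zero] at h3
  exact h3

end IsMixture

/-- The image under `σ` of the complex measure `w dP` is a complex Radon measure of finite total
variation. -/
theorem exists_complexRadonMeasure_map [IsFiniteMeasure P] (hw : Integrable w P)
    (hσ : Measurable σ) : ∃ ν : ComplexRadonMeasure, IsFiniteMeasure ν.variation ∧
      ∀ φ : ℝ≥0 → ℂ, Measurable φ → (∃ C, ∀ s, ‖φ s‖ ≤ C) →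
        ν.integral φ = ∫ ω, w ω * φ (σ ω) ∂P := by
  have hm : MeasurableSpace.comap σ inferInstance ≤ ‹MeasurableSpace Ω› := hσ.comap_le
  -- The conditional expectation of `w` given `σ` factors as `H ∘ σ`, so `w dP` has image `H d(σ_*
  -- P)`. Its polar decomposition is `|H| d(σ_* P)` with phase `H / |H|`; the value `1` on the null
  -- set `H = 0` only keeps the modulus equal to one.
  obtain ⟨H, hH, hHσ⟩ := (stronglyMeasurable_condExp (μ := P) (f := w)
    (m := MeasurableSpace.comap σ inferInstance)).exists_eq_measurable_comp
  have hHi : Integrable H (P.map σ) := by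
    rw [integrable_map_measure hH.aestronglyMeasurable hσ.aemeasurable, ← hHσ]
    exact integrable_condExp
  let V : Measure ℝ≥0 := (P.map σ).withDensity fun s => (‖H s‖₊ : ENNReal)
  have hV : IsFiniteMeasure V := isFiniteMeasure_withDensity hHi.2.ne
  refine ⟨⟨V, inferInstance, fun s => if H s = 0 then 1 else H s / ‖H s‖, ?_, fun s => ?_⟩, hV,
    fun φ hφ hC => ?_⟩
  · exact Measurable.ite (hH.measurable (measurableSet_singleton 0)) measurable_const
      (hH.measurable.div (Complex.measurable_ofReal.comp hH.measurable.norm))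
  · split_ifs with h
    · exact norm_one
    · rw [norm_div, Complex.norm_real, norm_norm, div_self (norm_ne_zero_iff.2 h)]
  · obtain ⟨C, hC⟩ := hC
    rw [ComplexRadonMeasure.integral,
      integral_withDensity_eq_integral_smul hH.measurable.nnnorm]
    have e : ∀ s, ‖H s‖₊ • (if H s = 0 then (1 : ℂ) else H s / ‖H s‖) • φ s = φ s * H s := by
      intro s
      rw [NNReal.smul_def, coe_nnnorm, ← Complex.coe_smul, smul_eq_mul, smul_eq_mul]
      split_ifs with h
      · simp [h]
      · have : ((‖H s‖ : ℝ) : ℂ) ≠ 0 := by exact_mod_cast norm_ne_zero_iff.2 h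
        field_simp
    simp only [e]
    rw [integral_map (f := fun s => φ s * H s) hσ.aemeasurable (hφ.mul hH.measurable).aestronglyMeasurable]
    have hφσ : StronglyMeasurable[MeasurableSpace.comap σ inferInstance] fun ω => φ (σ ω) :=
      (hφ.comp (comap_measurable σ)).stronglyMeasurable
    have hint : Integrable (fun ω => ContinuousLinearMap.mul ℝ ℂ (φ (σ ω)) (w ω)) P := by
      refine (hw.norm.const_mul C).mono' ?_ (ae_of_all _ fun ω => ?_)
      · exact (hφ.comp hσ).aestronglyMeasurable.mul hw.aestronglyMeasurable
      · rw [ContinuousLinearMap.mul_apply', norm_mul]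
        gcongr
        exact hC _
    -- Since `φ ∘ σ` is measurable for `σ`, it can be pulled out of the conditional expectation.
    have hpull := condExp_bilin_of_stronglyMeasurable_left (ContinuousLinearMap.mul ℝ ℂ) hφσ hint hw
    rw [hHσ] at hpull
    simp only [ContinuousLinearMap.mul_apply', Function.comp_apply] at hpull
    rw [← integral_congr_ae hpull, integral_condExp hm]
    simp only [mul_comm]

theorem IsMixture.exists_isStieltjesRep {m : ℕ} {f : ℂ → ℂ} {T : X → X}
    (h : IsMixture r m 0 f T) : ∃ ν, IsStieltjesRep m ν f := by
  obtain ⟨Ω, _, P, w, σ, τ, hP, hw, hσ, hτ, hf, hT⟩ := h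
  obtain ⟨ν, hν, hint⟩ := exists_complexRadonMeasure_map hw hσ
  refine ⟨ν, hν, fun z hz => ?_⟩
  rw [hf z hz, hint, mixture_scalarFamily_zero]
  · fun_prop
  · obtain ⟨c, hc, ε, hε, -, h⟩ := exists_le_norm_one_add_mul hz
    refine ⟨(c ^ m)⁻¹, fun s => ?_⟩
    simpa using norm_pow_div_le hc (h z (Metric.mem_ball_self hε) s) m 0

theorem IsMixture.mem_boundedStieltjes {m : ℕ} (hm : 1 ≤ m) {f : ℂ → ℂ}
    {T : X → X} (h : IsMixture r m 0 f T) : f ∈ boundedStieltjes :=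
  ⟨m, hm, h.exists_isStieltjesRep⟩

theorem IsStieltjesRep.isMixture [CompleteSpace X] (hr : IsResolventFamily r) {m : ℕ} {f : ℂ → ℂ}
    {ν : ComplexRadonMeasure} (h : IsStieltjesRep m ν f) :
    IsMixture r m 0 f fun x => ν.integral (fun s => r s ^ m) x := by
  have hfin := h.1
  have hphase : Integrable ν.phase ν.variation := by
    refine (integrable_const (1 : ℝ)).mono' ν.measurable_phase.aestronglyMeasurable
      (ae_of_all _ fun s => (ν.norm_phase s).le)
  refine ⟨ℝ≥0, inferInstance, ν.variation, ν.phase, id, id, h.1, hphase, measurable_id,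
    measurable_id, fun z hz => ?_, fun x => ?_⟩
  · rw [h.2 z hz, mixture_scalarFamily_zero]
    rfl
  · obtain ⟨M, hM0, hM⟩ := hr.exists_nonneg_bound
    have hint : Integrable (fun s => ν.phase s • r s ^ m) ν.variation := by
      refine (integrable_const (M ^ m)).mono' ?_ (ae_of_all _ fun s => ?_)
      · refine ν.measurable_phase.aestronglyMeasurable.smul ?_
        -- The integral takes values in the operators, and norm continuity is available only off
        -- `0`; the point `0` is split off for measurability.
        have hu : ({0}ᶜ : Set ℝ≥0) ∪ {0} = Set.univ := Set.compl_union_self _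
        rw [← Measure.restrict_univ (μ := ν.variation), ← hu, aestronglyMeasurable_union_iff]
        refine ⟨ContinuousOn.aestronglyMeasurable (fun s hs => ?_)
          (measurableSet_singleton _).compl,
          (continuousOn_singleton _ _).aestronglyMeasurable (measurableSet_singleton _)⟩
        exact ((hr.continuousAt hs).pow m).continuousWithinAt
      · rw [norm_smul, ν.norm_phase, one_mul]
        exact ContinuousLinearMap.opNorm_le_bound _ (by positivity) fun x =>
          IsResolventFamily.norm_pow_apply_le hM m s x
    beta_reduce
    rw [ComplexRadonMeasure.integral, ContinuousLinearMap.integral_apply hint, mixture]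
    simp

end Mixture

/-! ### The Stieltjes calculus: well-definedness and multiplicativity -/

section StieltjesMap

variable {X : Type*} [NormedAddCommGroup X] [NormedSpace ℂ X] [CompleteSpace X] {A : X →ₗ.[ℂ] X}

theorem IsSectorial.exists_isMixture_stieltjesMap (hA : IsSectorial A) {f : ℂ → ℂ}
    (hf : f ∈ boundedStieltjes) :
    ∃ m, 1 ≤ m ∧ IsMixture (resolventOp A) m 0 f (stieltjesMap A f) := by
  have h : ∃ p : ℕ × ComplexRadonMeasure, 1 ≤ p.1 ∧ IsStieltjesRep p.1 p.2 f := by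
    obtain ⟨n, hn, ν, hν⟩ := hf
    exact ⟨(n, ν), hn, hν⟩
  refine ⟨h.choose.1, h.choose_spec.1, ?_⟩
  rw [stieltjesMap, dif_pos h]
  exact h.choose_spec.2.isMixture hA.isResolventFamily

/-- By uniqueness, the representation chosen in `stieltjesMap` is immaterial: any mixture computes
`Φ(f)`. -/
theorem IsMixture.stieltjesMap_apply (hA : IsSectorial A) {m : ℕ} (hm : 1 ≤ m) {f : ℂ → ℂ}
    {T : X → X} (h : IsMixture (resolventOp A) m 0 f T) (x : X) : stieltjesMap A f x = T x := by
  obtain ⟨k, hk, h'⟩ := hA.exists_isMixture_stieltjesMap (h.mem_boundedStieltjes hm)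
  exact h'.unique hA.isResolventFamily hk hm h (fun _ _ => rfl) x

/-- Both compositions collapse to single mixtures with the same function. This is the form of
multiplicativity needed to compare two regularisers. -/
theorem stieltjesMap_comp_eq (hA : IsSectorial A) {f g f' g' : ℂ → ℂ} (hf : f ∈ boundedStieltjes)
    (hg : g ∈ boundedStieltjes) (hf' : f' ∈ boundedStieltjes) (hg' : g' ∈ boundedStieltjes)
    (h : ∀ z ∈ Complex.slitPlane, f z * g z = f' z * g' z) (x : X) :
    stieltjesMap A f (stieltjesMap A g x) = stieltjesMap A f' (stieltjesMap A g' x) := by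
  have hr := hA.isResolventFamily
  obtain ⟨a, ha, hfm⟩ := hA.exists_isMixture_stieltjesMap hf
  obtain ⟨b, hb, hgm⟩ := hA.exists_isMixture_stieltjesMap hg
  obtain ⟨a', ha', hfm'⟩ := hA.exists_isMixture_stieltjesMap hf'
  obtain ⟨b', hb', hgm'⟩ := hA.exists_isMixture_stieltjesMap hg'
  exact ((hfm.comp hr hgm).collapse hr ha).unique hr (by omega) (by omega)
    ((hfm'.comp hr hgm').collapse hr ha') h x

end StieltjesMap

/-! ### Regularisation by `(1 + z)⁻ⁿ` -/

section Binomial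

variable {X : Type*} [NormedAddCommGroup X] [NormedSpace ℂ X] {r : ℝ≥0 → X →L[ℂ] X}

theorem one_sub_pow_eq_sum {R : Type*} [Ring R] [Algebra ℂ R] (T : R) (n : ℕ) :
    (1 - T) ^ n = ∑ k ∈ Finset.range (n + 1), ((-1 : ℂ) ^ k * (n.choose k : ℂ)) • T ^ k := by
  rw [sub_eq_add_neg, add_comm, (Commute.one_right (-T)).add_pow]
  refine Finset.sum_congr rfl fun k _ => ?_
  rw [one_pow, mul_one, neg_pow, Algebra.smul_def, map_mul, map_pow, map_neg, map_one, map_natCast,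
    mul_assoc, mul_assoc, (Nat.cast_commute _ _).eq]

theorem IsResolventFamily.integral_one_sub_pow {Ω : Type*} [MeasurableSpace Ω] {P : Measure Ω}
    {w : Ω → ℂ} {σ τ : Ω → ℝ≥0} (hr : IsResolventFamily r) (a n : ℕ) (hw : Integrable w P)
    (hσ : Measurable σ) (hτ : Measurable τ) (x : X) :
    ∫ ω, w ω • (r (σ ω) ^ a * (1 - r (τ ω)) ^ n) x ∂P
      = ∑ k ∈ Finset.range (n + 1), ((-1 : ℂ) ^ k * (n.choose k : ℂ)) •
        mixture r a k P w σ τ x := by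
  simp only [mixture, ← integral_smul]
  have hI : ∀ k ∈ Finset.range (n + 1), Integrable (fun ω =>
      ((-1 : ℂ) ^ k * (n.choose k : ℂ)) • w ω • (r (σ ω) ^ a * r (τ ω) ^ k) x) P := fun k _ =>
    (hr.integrable_mixture a k hw hσ hτ x).smul _
  rw [← integral_finsetSum _ hI]
  refine integral_congr_ae (ae_of_all _ fun ω => ?_)
  simp only [one_sub_pow_eq_sum, Finset.mul_sum, mul_smul_comm, sum_apply,
    Finset.smul_sum]
  refine Finset.sum_congr rfl fun k _ => ?_
  rw [smul_apply, smul_comm (w ω)]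

/-- The binomial expansion yields mixtures of total orders `a + k` with `k ≤ n`; raising each by `n
- k` makes them summable at order `a + n`. -/
theorem isMixture_one_sub_pow [CompleteSpace X] (hr : IsResolventFamily r) {Ω : Type}
    [MeasurableSpace Ω] {P : Measure Ω} [IsFiniteMeasure P] {w : Ω → ℂ} {σ τ : Ω → ℝ≥0} {a : ℕ}
    (ha : 1 ≤ a) (n : ℕ) (hw : Integrable w P) (hσ : Measurable σ) (hτ : Measurable τ) :
    IsMixture r (a + n) 0
      (fun z => ∫ ω, w ω * (1 / (1 + z * ((σ ω : ℝ) : ℂ)) ^ a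
        * (1 - 1 / (1 + z * ((τ ω : ℝ) : ℂ))) ^ n) ∂P)
      (fun x => ∫ ω, w ω • (r (σ ω) ^ a * (1 - r (τ ω)) ^ n) x ∂P) := by
  have h : ∀ k ∈ Finset.range (n + 1), IsMixture r (a + n) 0
      (fun z => ((-1 : ℂ) ^ k * (n.choose k : ℂ)) * mixture (scalarFamily z) a k P w σ τ 1)
      (fun x => ((-1 : ℂ) ^ k * (n.choose k : ℂ)) • mixture r a k P w σ τ x) := fun k hk => by
    have h1 : IsMixture r a k (fun z => mixture (scalarFamily z) a k P w σ τ 1)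
        (fun x => mixture r a k P w σ τ x) :=
      ⟨Ω, _, P, w, σ, τ, inferInstance, hw, hσ, hτ, fun _ _ => rfl, fun _ => rfl⟩
    have h2 := (h1.collapse hr ha).raise hr (by omega) (n - k)
    rw [Finset.mem_range] at hk
    rw [show a + k + (n - k) = a + n by omega] at h2
    exact h2.smul _
  refine (IsMixture.sum hr _ h).congr (fun z hz => ?_) fun x => ?_
  · have := (isResolventFamily_scalarFamily hz).integral_one_sub_pow a n hw hσ hτ 1
    simp only [smul_eq_mul] at this
    rw [← this]
    refine integral_congr_ae (ae_of_all _ fun ω => ?_)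
    have e : ∀ c : ℂ, (1 : ℂ →L[ℂ] ℂ) - c • 1 = (1 - c : ℂ) • (1 : ℂ →L[ℂ] ℂ) := fun c =>
      ContinuousLinearMap.ext_ring (by simp)
    simp [scalarFamily, e, smul_pow, mul_comm]
  · exact hr.integral_one_sub_pow a n hw hσ hτ x

theorem isMixture_one_div_one_add_pow [CompleteSpace X] (n : ℕ) :
    IsMixture r n 0 (fun z => 1 / (1 + z) ^ n) (fun x => (r 1 ^ n) x) := by
  refine ⟨Unit, inferInstance, Measure.dirac (), fun _ => 1, fun _ => 1, fun _ => 1,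
    inferInstance, integrable_const _, measurable_const, measurable_const, fun z _ => ?_,
    fun x => ?_⟩
  · rw [mixture_scalarFamily_zero]
    simp
  · simp [mixture]

end Binomial

theorem differentiableOn_of_mem_boundedStieltjes {f : ℂ → ℂ} (hf : f ∈ boundedStieltjes) :
    DifferentiableOn ℂ f Complex.slitPlane := by
  obtain ⟨m, -, ν, hν, hf⟩ := hf
  have hphase : Integrable ν.phase ν.variation :=
    (integrable_const (1 : ℝ)).mono' ν.measurable_phase.aestronglyMeasurable
      (ae_of_all _ fun s => (ν.norm_phase s).le)
  exact (differentiableOn_integral_one_div hphase measurable_id m).congr hf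

theorem ComplexRadonMeasure.integrable_phase_mul {n : ℕ} {μ : ComplexRadonMeasure}
    (hμ : IsAdmissible n μ) {z : ℂ} (hz : z ∈ Complex.slitPlane) :
    Integrable (fun s => μ.phase s • (z ^ n / (1 + z * ((s : ℝ) : ℂ)) ^ n)) μ.variation := by
  obtain ⟨c, hc, ε, hε, -, h⟩ := exists_le_norm_one_add_mul hz
  refine (hμ.const_mul (‖z‖ ^ n / c ^ n)).mono' ?_ (ae_of_all _ fun s => ?_)
  · exact μ.measurable_phase.aestronglyMeasurable.smul
      (Measurable.aestronglyMeasurable (by fun_prop))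
  · rw [norm_smul, μ.norm_phase, one_mul, norm_div, norm_pow, norm_pow]
    calc ‖z‖ ^ n / ‖1 + z * ((s : ℝ) : ℂ)‖ ^ n ≤ ‖z‖ ^ n / (c * (1 + (s : ℝ))) ^ n := by
          gcongr
          exact h z (Metric.mem_ball_self hε) s
      _ = ‖z‖ ^ n / c ^ n * (1 / (1 + (s : ℝ)) ^ n) := by
          rw [mul_pow]
          field_simp

/-- The finite measure `s⁻ⁿ |μ|(ds)` on `(1, ∞)`. -/
def ComplexRadonMeasure.tail (n : ℕ) (μ : ComplexRadonMeasure) : Measure ℝ≥0 :=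
  (μ.variation.restrict (Set.Ioi 1)).withDensity fun s => (((s ^ n)⁻¹ : ℝ≥0) : ENNReal)

theorem ComplexRadonMeasure.integral_tail {E : Type*} [NormedAddCommGroup E] [NormedSpace ℂ E]
    (n : ℕ) (μ : ComplexRadonMeasure) (g : ℝ≥0 → E) :
    ∫ s, g s ∂μ.tail n = ∫ s in Set.Ioi 1, (((s : ℝ) : ℂ)⁻¹ ^ n) • g s ∂μ.variation := by
  rw [tail, integral_withDensity_eq_integral_smul (by fun_prop)]
  refine integral_congr_ae (ae_of_all _ fun s => ?_)
  dsimp only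
  rw [NNReal.smul_def, ← Complex.coe_smul]
  push_cast
  rw [inv_pow]

theorem ComplexRadonMeasure.isFiniteMeasure_tail {n : ℕ} {μ : ComplexRadonMeasure}
    (hμ : IsAdmissible n μ) : IsFiniteMeasure (μ.tail n) := by
  refine isFiniteMeasure_withDensity ?_
  have h : Integrable (fun s : ℝ≥0 => ((s : ℝ) ^ n)⁻¹) (μ.variation.restrict (Set.Ioi 1)) := by
    -- For `s > 1` one has `1 + s ≤ 2s`, hence `s⁻ⁿ ≤ 2ⁿ(1 + s)⁻ⁿ`.
    refine (hμ.restrict.const_mul (2 ^ n)).mono' (Measurable.aestronglyMeasurable (by fun_prop)) ?_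
    filter_upwards [ae_restrict_mem measurableSet_Ioi] with s hs
    have hs1 : (1 : ℝ) < s := by exact_mod_cast (hs : 1 < s)
    rw [Real.norm_eq_abs, abs_of_nonneg (by positivity), mul_one_div, le_div_iff₀ (by positivity),
      inv_mul_le_iff₀ (by positivity), ← mul_pow]
    gcongr
    linarith
  have h2 := h.2.ne
  refine ne_of_eq_of_ne (lintegral_congr fun s => ?_) h2
  have e : ((s : ℝ) ^ n)⁻¹ = (((s ^ n)⁻¹ : ℝ≥0) : ℝ) := by push_cast; rfl
  dsimp only
  rw [e, Real.enorm_eq_ofReal (NNReal.coe_nonneg _), ENNReal.ofReal_coe_nnreal]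

/-! ### The Hirsch-type operator and its closure -/

section Hirsch

variable {X : Type*} [NormedAddCommGroup X] [NormedSpace ℂ X] {A : X →ₗ.[ℂ] X}

theorem yosidaOp_one : yosidaOp A 1 = 1 - resolventOp A 1 := by
  simp [yosidaOp]

theorem IsSectorial.commute_resolventOp_yosidaOp (hA : IsSectorial A) (s t : ℝ≥0) :
    Commute (resolventOp A s) (yosidaOp A t) :=
  ((Commute.one_right _).sub_right (hA.isResolventFamily.commute s t)).smul_right _

theorem IsSectorial.resolventOp_injective (hA : IsSectorial A) {s : ℝ≥0} (hs : 0 < s) :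
    Function.Injective (resolventOp A s) := by
  intro x y hxy
  obtain ⟨h, hx⟩ := (hA.isBoundedInverse hs).1 x
  obtain ⟨h', hy⟩ := (hA.isBoundedInverse hs).1 y
  rw [← hx, ← hy]
  congr 1
  exact Subtype.ext hxy

theorem IsSectorial.resolventOp_pow_injective (hA : IsSectorial A) (n : ℕ) {s : ℝ≥0}
    (hs : 0 < s) : Function.Injective (resolventOp A s ^ n) := by
  induction n with
  | zero => exact fun x y h => h
  | succ n ih =>
    intro x y h
    rw [pow_succ', mul_apply_eq_comp, mul_apply_eq_comp] at h
    exact ih (hA.resolventOp_injective hs h)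

/-- Both sides are `A(1 + sA)⁻¹(1 + tA)⁻¹`; for the bounded operators this is the resolvent
equation. -/
theorem IsSectorial.resolventOp_mul_yosidaOp (hA : IsSectorial A) {s t : ℝ≥0} (hs : 0 < s)
    (ht : 0 < t) : resolventOp A s * yosidaOp A t = resolventOp A t * yosidaOp A s := by
  have hs0 : ((s : ℝ) : ℂ) ≠ 0 := by exact_mod_cast hs.ne'
  have ht0 : ((t : ℝ) : ℂ) ≠ 0 := by exact_mod_cast ht.ne'
  have h := hA.isResolventFamily.resolvent_eq s t
  have hc := (hA.isResolventFamily.commute s t).eq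
  simp only [yosidaOp, mul_smul_comm, mul_sub, mul_one]
  rw [inv_smul_eq_iff₀ ht0, smul_comm, eq_inv_smul_iff₀ hs0, smul_sub, smul_sub, ← hc,
    sub_eq_sub_iff_sub_eq_sub, h, sub_smul]

/-- The vectors `A ^ n (1 + s A)⁻ⁿ (1 + A)⁻ⁿ x` for arbitrary `x`, in two forms. -/
theorem IsSectorial.hirschIntegrand_resolventOp_of_pos (hA : IsSectorial A) (n : ℕ) (x : X)
    (h : (resolventOp A 1 ^ n) x ∈ (opPow A n).domain) {s : ℝ≥0} (hs : 0 < s) :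
    hirschIntegrand hA n ⟨_, h⟩ s = (resolventOp A 1 ^ n * yosidaOp A s ^ n) x := by
  rw [hirschIntegrand_of_pos hA n _ hs, ← mul_apply_eq_comp,
    ((hA.commute_resolventOp_yosidaOp 1 s).pow_pow n n).eq]

/-- Attaching `Aⁿ` to `(1 + A)⁻ⁿ` instead of `(1 + sA)⁻ⁿ` avoids `s⁻ⁿ`, so this form holds down to
`s = 0` and serves on `[0, 1]`. -/
theorem IsSectorial.hirschIntegrand_resolventOp (hA : IsSectorial A) (n : ℕ) (x : X)
    (h : (resolventOp A 1 ^ n) x ∈ (opPow A n).domain) (s : ℝ≥0) :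
    hirschIntegrand hA n ⟨_, h⟩ s = (resolventOp A s ^ n * yosidaOp A 1 ^ n) x := by
  rcases eq_or_lt_of_le (zero_le (a := s)) with rfl | hs
  · rw [hirschIntegrand_zero, resolventOp_zero, one_pow, one_mul]
    exact (hA.opPow_resolventOp one_pos n x).2
  · rw [hA.hirschIntegrand_resolventOp_of_pos n x h hs,
      ← (hA.commute_resolventOp_yosidaOp 1 s).mul_pow, ← (hA.commute_resolventOp_yosidaOp s 1).mul_pow,
      hA.resolventOp_mul_yosidaOp hs one_pos]

theorem IsSectorial.hirschIntegrand_resolventOp_pow (hA : IsSectorial A) (n : ℕ)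
    (x : (opPow A n).domain) {t : ℝ≥0} (ht : 0 < t) (s : ℝ≥0) :
    hirschIntegrand hA n ⟨_, hA.resolventOp_pow_mem n t x⟩ s
      = (resolventOp A t ^ n) (hirschIntegrand hA n x s) := by
  rcases eq_or_lt_of_le (zero_le (a := s)) with rfl | hs
  · rw [hirschIntegrand_zero, hirschIntegrand_zero, ← hA.yosidaOp_pow_apply ht]
    exact (hA.opPow_resolventOp ht n x).2
  · rw [hirschIntegrand_of_pos hA n _ hs, hirschIntegrand_of_pos hA n _ hs, ← mul_apply_eq_comp,
      ← mul_apply_eq_comp, ((hA.commute_resolventOp_yosidaOp t s).pow_pow n n).eq]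

theorem mem_graph_opComp {B A : X →ₗ.[ℂ] X} {x y : X} :
    (x, y) ∈ (opComp B A).graph ↔ ∃ u, (x, u) ∈ A.graph ∧ (u, y) ∈ B.graph := by
  simp only [LinearPMap.mem_graph_iff]
  constructor
  · rintro ⟨⟨x', hx'⟩, rfl, hy⟩
    obtain ⟨h, hB⟩ := mem_opComp_domain.1 hx'
    exact ⟨A ⟨x', h⟩, ⟨⟨x', h⟩, rfl, rfl⟩, ⟨⟨_, hB⟩, rfl, hy⟩⟩
  · rintro ⟨u, ⟨⟨x', h⟩, rfl, hu⟩, ⟨⟨u', hu'⟩, rfl, hy⟩⟩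
    simp only at hu hy
    subst hu
    exact ⟨⟨x', mem_opComp_domain.2 ⟨h, hu'⟩⟩, rfl, hy⟩

/-- Injectivity of `Φ(e)` turns the inverse into a reversed graph, so the domain condition and the
value merge into one equation between bounded operators. -/
theorem mem_graph_regularisedOp {e f : ℂ → ℂ} (he : Function.Injective (stieltjesMap A e))
    {x y : X} : (x, y) ∈ (regularisedOp A e f).graph ↔
      stieltjesMap A (fun z => e z * f z) x = stieltjesMap A e y := by
  have hker : ((stieltjesMap A e).toLinearMap.toPMap ⊤).toFun.ker = ⊥ := by
    rw [LinearMap.ker_eq_bot]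
    intro x y hxy
    exact Subtype.ext (he hxy)
  rw [regularisedOp, mem_graph_opComp, LinearPMap.inverse_graph hker]
  simp [LinearPMap.mem_graph_iff, eq_comm]

/-- The underlying function of the Hirsch-type operator. -/
def hirschFun (hA : IsSectorial A) {n : ℕ} (a : ℂ) (μ : ComplexRadonMeasure)
    (x : (opPow A n).domain) : X :=
  a • (x : X) + μ.integral (hirschIntegrand hA n x)

theorem mem_graph_hirschOp (hA : IsSectorial A) {n : ℕ} {a : ℂ} {μ : ComplexRadonMeasure}
    (hμ : IsAdmissible n μ) {x y : X} :
    (x, y) ∈ (hirschOp hA a hμ).graph ↔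
      ∃ h : x ∈ (opPow A n).domain, hirschFun hA a μ ⟨x, h⟩ = y := by
  rw [LinearPMap.mem_graph_iff]
  constructor
  · rintro ⟨x', rfl, hy⟩
    exact ⟨x'.2, hy⟩
  · rintro ⟨h, hy⟩
    exact ⟨⟨x, h⟩, rfl, hy⟩

variable [CompleteSpace X] {n : ℕ} {a : ℂ} {μ : ComplexRadonMeasure}

theorem hirschFun_resolventOp_pow (hA : IsSectorial A) (hμ : IsAdmissible n μ)
    (x : (opPow A n).domain) {t : ℝ≥0} (ht : 0 < t) :
    hirschFun hA a μ ⟨_, hA.resolventOp_pow_mem n t x⟩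
      = (resolventOp A t ^ n) (hirschFun hA a μ x) := by
  rw [hirschFun, hirschFun, map_add, map_smul, ComplexRadonMeasure.integral,
    ComplexRadonMeasure.integral,
    ← ContinuousLinearMap.integral_comp_comm _ (hA.integrable_hirschIntegrand hμ x)]
  simp only [hA.hirschIntegrand_resolventOp_pow n x ht, map_smul]

/-- The regularised function `(1 + z)⁻ⁿ f(z)` corresponds to the operator `f̂(A) (1 + A)⁻ⁿ`. -/
theorem IsBernsteinRep.isMixture (hA : IsSectorial A) (hn : 1 ≤ n) {f : ℂ → ℂ}
    (hf : IsBernsteinRep n a μ f) :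
    IsMixture (resolventOp A) (n + n) 0 (fun z => 1 / (1 + z) ^ n * f z) fun x =>
      hirschFun hA a μ ⟨(resolventOp A 1 ^ n) x, (hA.opPow_resolventOp one_pos n x).1⟩ := by
  have hr := hA.isResolventFamily
  have hloc := μ.locallyFinite
  have hfin := ComplexRadonMeasure.isFiniteMeasure_tail hf.1
  have hIic : IsFiniteMeasure (μ.variation.restrict (Set.Iic 1)) := by
    refine ⟨?_⟩
    rw [Measure.restrict_apply_univ, ← Set.Icc_bot]
    exact isCompact_Icc.measure_lt_top
  have hphase : ∀ P : Measure ℝ≥0, IsFiniteMeasure P → Integrable μ.phase P := fun P _ =>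
    (integrable_const (1 : ℝ)).mono' μ.measurable_phase.aestronglyMeasurable
      (ae_of_all _ fun s => (μ.norm_phase s).le)
  -- The three summands belong to `a`, to `[0, 1]` and to `(1, ∞)`. On `[0, 1]`, where `|μ|` is
  -- finite, `zⁿ` joins `(1 + z)⁻ⁿ` as `(1 - (1 + z)⁻¹)ⁿ`. On `(1, ∞)` it joins `(1 + zs)⁻ⁿ` as
  -- `s⁻ⁿ(1 - (1 + zs)⁻¹)ⁿ`, and `s⁻ⁿ` makes the measure finite.
  have h0 := (((isMixture_one_div_one_add_pow (r := resolventOp A) n).raise hr hn n).smul a)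
  have h1 := isMixture_one_sub_pow hr hn n (hphase _ hIic) measurable_id
    (measurable_const (a := (1 : ℝ≥0)))
  have h2 := isMixture_one_sub_pow hr hn n (hphase _ hfin) (measurable_const (a := (1 : ℝ≥0)))
    measurable_id
  refine (h0.add hr (h1.add hr h2)).congr (fun z hz => ?_) fun x => ?_
  · have hz1 : 1 + z ≠ 0 := by simpa using one_add_mul_ne_zero hz 1
    rw [ComplexRadonMeasure.integral_tail, hf.2 z hz, ComplexRadonMeasure.integral,
      ← integral_add_compl measurableSet_Iic (ComplexRadonMeasure.integrable_phase_mul hf.1 hz),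
      Set.compl_Iic, mul_add, mul_add, ← integral_const_mul, ← integral_const_mul]
    congr 1
    · ring
    congr 1
    · refine integral_congr_ae (ae_of_all _ fun s => ?_)
      have e : 1 - 1 / (1 + z) = z / (1 + z) := by
        field_simp
        ring
      simp only [id, NNReal.coe_one, Complex.ofReal_one, mul_one, e, smul_eq_mul, div_pow]
      simp only [div_eq_mul_inv]
      ring
    · refine setIntegral_congr_fun measurableSet_Ioi fun s hs => ?_
      have hs0 : ((s : ℝ) : ℂ) ≠ 0 := by
        exact_mod_cast (zero_lt_one.trans (hs : 1 < s)).ne'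
      have hne := one_add_mul_ne_zero hz s
      have e : 1 - 1 / (1 + z * ((s : ℝ) : ℂ)) = z * ((s : ℝ) : ℂ) / (1 + z * ((s : ℝ) : ℂ)) := by
        rw [eq_div_iff hne, sub_mul, div_mul_cancel₀ _ hne]
        ring
      simp only [id, NNReal.coe_one, Complex.ofReal_one, mul_one, e, smul_eq_mul, div_pow, mul_pow,
        inv_pow]
      field_simp
  · have hI := hA.integrable_hirschIntegrand hf.1
      ⟨(resolventOp A 1 ^ n) x, (hA.opPow_resolventOp one_pos n x).1⟩
    rw [ComplexRadonMeasure.integral_tail, hirschFun, ComplexRadonMeasure.integral,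
      ← integral_add_compl measurableSet_Iic hI, Set.compl_Iic]
    congr 1
    congr 1
    · refine integral_congr_ae (ae_of_all _ fun s => ?_)
      simp only [hA.hirschIntegrand_resolventOp n x, yosidaOp_one, id]
    · refine setIntegral_congr_fun measurableSet_Ioi fun s hs => ?_
      have hs0 : 0 < s := zero_lt_one.trans hs
      simp only [hA.hirschIntegrand_resolventOp_of_pos n x _ hs0, id, yosidaOp, smul_pow,
        mul_smul_comm, smul_apply]
      rw [smul_comm]

/-- Apply the injective `Φ(e')` to `Φ(ef)x = Φ(e)y`. Multiplicativity gives `Φ(e)Φ(e'f)x =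
Φ(e)Φ(e')y`, and the injective `Φ(e)` cancels. -/
theorem regularisedOp_eq (hA : IsSectorial A) {f e e' : ℂ → ℂ} (he : e ∈ regularisers A f)
    (he' : e' ∈ regularisers A f) : regularisedOp A e f = regularisedOp A e' f := by
  obtain ⟨-, hm, hmf, hi⟩ := he
  obtain ⟨-, hm', hmf', hi'⟩ := he'
  refine LinearPMap.eq_of_eq_graph (Submodule.ext fun ⟨x, y⟩ => ?_)
  have h1 := stieltjesMap_comp_eq hA hm' hmf hm hmf' (fun z _ => by ring) x
  have h2 := stieltjesMap_comp_eq hA hm' hm hm hm' (fun z _ => by ring) y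
  rw [mem_graph_regularisedOp hi, mem_graph_regularisedOp hi', ← hi'.eq_iff, h1, h2, hi.eq_iff]

theorem one_div_one_add_pow_mem_regularisers (hA : IsSectorial A) (hn : 1 ≤ n) {f : ℂ → ℂ}
    (hf : IsBernsteinRep n a μ f) : (fun z : ℂ => 1 / (1 + z) ^ n) ∈ regularisers A f := by
  have hef := (hf.isMixture hA hn).mem_boundedStieltjes (by omega)
  have he := isMixture_one_div_one_add_pow (r := resolventOp A) n
  refine ⟨?_, he.mem_boundedStieltjes hn, hef, ?_⟩
  -- Holomorphy of `f` follows from `f = (1 + z)ⁿ · (ef)`, since members of the bounded Stieltjes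
  -- algebra are holomorphic.
  · have h : DifferentiableOn ℂ (fun z : ℂ => (1 + z) ^ n) Complex.slitPlane := by fun_prop
    refine (h.mul (differentiableOn_of_mem_boundedStieltjes hef)).congr fun z hz => ?_
    have hz1 : 1 + z ≠ 0 := by simpa using one_add_mul_ne_zero hz 1
    simp only [Pi.mul_apply]
    field_simp
  · have : ⇑(stieltjesMap A fun z : ℂ => 1 / (1 + z) ^ n) = ⇑(resolventOp A 1 ^ n) :=
      funext fun x => he.stieltjesMap_apply hA hn x
    rw [this]
    exact hA.resolventOp_pow_injective n one_pos

theorem topologicalClosure_graph_hirschOp (hA : IsSectorial A) (hn : 1 ≤ n) {f : ℂ → ℂ}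
    (hf : IsBernsteinRep n a μ f) : (hirschOp hA a hf.1).graph.topologicalClosure
      = (regularisedOp A (fun z => 1 / (1 + z) ^ n) f).graph := by
  have hi := (one_div_one_add_pow_mem_regularisers hA hn hf).2.2.2
  have hgraph : ∀ x y, (x, y) ∈ (regularisedOp A (fun z => 1 / (1 + z) ^ n) f).graph ↔
      hirschFun hA a μ ⟨(resolventOp A 1 ^ n) x, (hA.opPow_resolventOp one_pos n x).1⟩
        = (resolventOp A 1 ^ n) y := fun x y => by
    rw [mem_graph_regularisedOp hi, (hf.isMixture hA hn).stieltjesMap_apply hA (by omega),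
      (isMixture_one_div_one_add_pow n).stieltjesMap_apply hA hn]
  refine le_antisymm (Submodule.topologicalClosure_minimal _ ?_ ?_) ?_
  -- `f̂(A)` commutes with `(1 + A)⁻ⁿ` on its domain, so its graph lies in the closed one.
  · rintro ⟨x, y⟩ hxy
    obtain ⟨h, rfl⟩ := (mem_graph_hirschOp hA hf.1).1 hxy
    rw [hgraph]
    exact hirschFun_resolventOp_pow hA hf.1 ⟨x, h⟩ one_pos
  · have : ((regularisedOp A (fun z => 1 / (1 + z) ^ n) f).graph : Set (X × X))
        = {p | stieltjesMap A (fun z => 1 / (1 + z) ^ n * f z) p.1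
          = stieltjesMap A (fun z => 1 / (1 + z) ^ n) p.2} :=
      Set.ext fun ⟨x, y⟩ => mem_graph_regularisedOp hi
    rw [this]
    exact isClosed_eq (by fun_prop) (by fun_prop)
  · rintro ⟨x, y⟩ hxy
    rw [hgraph] at hxy
    have hr := hA.isResolventFamily
    -- The approximants `(1 + tA)⁻ⁿ(x, y)` with `t > 0` have first component in `dom(Aⁿ)`.
    have hlim : Filter.Tendsto
        (fun t : ℝ≥0 => ((resolventOp A t ^ n) x, (resolventOp A t ^ n) y))
        (nhdsWithin 0 (Set.Ioi 0)) (nhds (x, y)) := by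
      have hc : Continuous fun t : ℝ≥0 => ((resolventOp A t ^ n) x, (resolventOp A t ^ n) y) :=
        (hr.continuous_pow_apply n continuous_id continuous_const).prodMk
          (hr.continuous_pow_apply n continuous_id continuous_const)
      have := (hc.tendsto 0).mono_left (nhdsWithin_le_nhds (s := Set.Ioi (0 : ℝ≥0)))
      simpa [resolventOp_zero] using this
    refine mem_closure_of_tendsto hlim ?_
    filter_upwards [self_mem_nhdsWithin] with t ht
    have ht0 : 0 < t := ht
    have hmem : (resolventOp A t ^ n) x ∈ (opPow A n).domain :=
      (hA.opPow_resolventOp ht0 n x).1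
    -- The value of `f̂(A)` at the approximant is identified after applying the injective `(1 +
    -- A)⁻ⁿ`, where the equation for `(x, y)` can be used.
    refine (mem_graph_hirschOp hA hf.1).2 ⟨hmem, hA.resolventOp_pow_injective n one_pos ?_⟩
    have hcomm : ∀ v, (resolventOp A 1 ^ n) ((resolventOp A t ^ n) v)
        = (resolventOp A t ^ n) ((resolventOp A 1 ^ n) v) := fun v => by
      rw [← mul_apply_eq_comp, ← mul_apply_eq_comp, ((hr.commute 1 t).pow_pow n n).eq]
    have e1 := hirschFun_resolventOp_pow (a := a) hA hf.1 ⟨_, hmem⟩ one_pos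
    have e2 := hirschFun_resolventOp_pow (a := a) hA hf.1
      ⟨_, (hA.opPow_resolventOp one_pos n x).1⟩ ht0
    rw [hxy] at e2
    simp only [hcomm] at e1 e2 ⊢
    rw [← e1, e2]

end Hirsch

end SectorialCalculus

end

theorem corollary4p10 {X : Type*} [NormedAddCommGroup X] [NormedSpace ℂ X] [CompleteSpace X]
    (A : X →ₗ.[ℂ] X) (hA : SectorialCalculus.IsSectorial A)
    (n : ℕ) (hn : 1 ≤ n) (f : ℂ → ℂ) (a : ℂ) (μ : SectorialCalculus.ComplexRadonMeasure)
    (hf : SectorialCalculus.IsBernsteinRep n a μ f) :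
    (fun z : ℂ => 1 / (1 + z) ^ n) ∈ SectorialCalculus.regularisers A f ∧
    (∀ e ∈ SectorialCalculus.regularisers A f,
      SectorialCalculus.regularisedOp A e f = SectorialCalculus.extendedStieltjes A f) ∧
    (SectorialCalculus.hirschOp hA a hf.1).IsClosable ∧
    SectorialCalculus.extendedStieltjes A f = (SectorialCalculus.hirschOp hA a hf.1).closure := by
  have hreg := SectorialCalculus.one_div_one_add_pow_mem_regularisers hA hn hf
  have hne : (SectorialCalculus.regularisers A f).Nonempty := ⟨_, hreg⟩
  have hS : ∀ e ∈ SectorialCalculus.regularisers A f,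
      SectorialCalculus.regularisedOp A e f = SectorialCalculus.extendedStieltjes A f := by
    intro e he
    rw [SectorialCalculus.extendedStieltjes, dif_pos hne]
    exact SectorialCalculus.regularisedOp_eq hA he hne.some_mem
  have hcl := SectorialCalculus.topologicalClosure_graph_hirschOp hA hn hf
  -- The closure of the graph is already known to be the graph of a linear operator.
  have hclosable : (SectorialCalculus.hirschOp hA a hf.1).IsClosable := ⟨_, hcl⟩
  refine ⟨hreg, hS, hclosable, ?_⟩
  rw [← hS _ hreg]
  exact LinearPMap.eq_of_eq_graph (hcl.symm.trans hclosable.graph_closure_eq_closure_graph)
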